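/- Let $a_1\ne a_2$, $d_1\neq d_2$, $d_3$ be real and $s_1,s_2>0$. For $Z\in Mat_{2\times 3}(\mathbb C)$ with rows $z,v$ put $A=\mathrm{diag}(a_1,a_2)$, $D=\mathrm{diag}(d_1,d_2,d_3)$, $H(Z)=\frac12\mathrm{Tr}(Z^+Z)^2+\mathrm{Tr}(AZDZ^+)$, $r_k=|z_k|^2-|v_k|^2$, $\eta_k=\bar v_kz_k$, $s_k(Z)=|z_k|^2+|v_k|^2$. On the leaf $\Sigma=S^2_{s_1}\times S^2_{s_2}=\{(r_k,\eta_k)_{k=1,2}: r_k^2+(2|\eta_k|)^2=s_k^2\}$ let $\{\cdot,\cdot\}$ be the Poisson bracket with $\{r_k,\eta_l\}=i\eta_k\delta_{kl}$, $\{\eta_k,\bar\eta_l\}=\frac i2r_k\delta_{kl}$, $\{r_k,r_l\}=\{\eta_k,\eta_l\}=0$; let $R=r_1+r_2$ and $$H=|\eta_1+\eta_2|^2+\tfrac14R^2+\tfrac12(a_1-a_2)(d_1r_1+d_2r_2)+\tfrac14(s_1+s_2)^2+\tfrac12(a_1+a_2)(d_1s_1+d_2s_2).$$ Trajectories are the solutions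 of $\dot f=\{f,H\}$. 1. Along every solution, defined for all times, of $\dot Z=i\,\partial H/\partial Z^+$ the functions $s_k(Z)$, $k=1,2,3$, are constant. If $s_3(Z)=0$ and $s_k(Z)=s_k$ for $k=1,2$, then $r_3=\eta_3=0$ for all times, $H(Z)$ equals the function $H$ on $\Sigma$, and $t\mapsto (r_k,\eta_k)_{k=1,2}(Z(-t/2))$ is a trajectory of $H$ on $\Sigma$. 2. In the coordinates $\eta_k=\frac12\sqrt{s_k^2-r_k^2}\,e^{i\phi_k}$, $|r_k|<s_k$, the bracket is the canonical one, $\{r_k,\phi_l\}=\delta_{kl}$ (symplectic form $dr_1\wedge d\phi_1+dr_2\wedge d\phi_2$). With $\sigma_\phi(r_k,\eta_k)=(r_k,e^{i\phi}\eta_k)$, the trajectories of $R$ on $\Sigma$ are exactly the curves $t\mapsto\sigma_{-t}(x)$, $x\in\Sigma$. 3. Let $r\in\mathbb R$. The part of the reduced space $(R^{-1}(r)\cap\Sigma)/\{\sigma_\phi\}$ where $\eta_1,\eta_2\ne0$ has global coordinates $r_1$ and $\psi_1=\phi_1-\phi_2$ mod $2\pi$, with $|r_1|<s_1$, $|r-r_1|<s_2$.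 The reduced symplectic form is $dr_1\wedge d\psi_1$ and the reduced Hamiltonian is $$H=\tfrac12\sqrt{(s_1^2-r_1^2)(s_2^2-(r-r_1)^2)}\cos\psi_1+w_2(r_1),$$ $$w_2(r_1)=-\tfrac14(r_1^2+(r-r_1)^2)+\tfrac14(s_1^2+s_2^2)+\tfrac14r^2+\tfrac12(a_1-a_2)(d_1r_1+d_2(r-r_1))+\tfrac14(s_1+s_2)^2+\tfrac12(a_1+a_2)(d_1s_1+d_2s_2).$$ While they stay in this part, trajectories of $H$ on $R^{-1}(r)\cap\Sigma$ over an open time interval project to solutions of $\dot r_1=\partial H/\partial\psi_1$, $\dot\psi_1=-\partial H/\partial r_1$, and each solution of these equations on an open interval is such a projection. 4. For $h\in\mathbb R$ put $w_4(r_1)=(s_1^2-r_1^2)(s_2^2-(r-r_1)^2)-4(h-w_2(r_1))^2$. The terms of fourth order cancel: $w_4$ is a polynomial of degree exactly $3$ with leading coefficient $2(a_1-a_2)(d_1-d_2)$. Consider a trajectory of $H$ on $\Sigma$ over an open time interval $J$ with $R=r$ and $H=h$ at one time. Then: * $R=r$ and $H=h$ at all times of $J$, and $4\dot r_1^2=w_4(r_1)$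 on $J$; * if $t_0<t_1$, $[t_0,t_1]\subset J$ and $w_4(r_1(t))>0$ for $t_0<t<t_1$, then $\dot r_1$ has a constant sign $\epsilon=\pm1$ on $(t_0,t_1)$, and $$t_1-t_0=\epsilon\int_{r_1(t_0)}^{r_1(t_1)}\frac{2\,dq}{\sqrt{w_4(q)}}$$ with an integrable integrand (an elliptic integral of the first kind); * if $w_4$ has no multiple root in $\mathbb C$, then $r_1$ is the restriction to $J$ of an elliptic function, i.e. of a meromorphic function on $\mathbb C$ with two periods linearly independent over $\mathbb R$; * at each $t\in J$ with $|r_1|<s_1$, $|r-r_1|<s_2$ let $$c=\arccos\frac{2(h-w_2(r_1))}{\sqrt{(s_1^2-r_1^2)(s_2^2-(r-r_1)^2)}}.$$ Then $\psi_1\equiv c$ mod $2\pi$ if $\dot r_1\le0$, and $\psi_1\equiv-c$ mod $2\pi$ if $\dot r_1\ge0$; in particular $\psi_1=c$ if $\psi_1\in[0,\pi]$. -/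

import Mathlib

namespace NWave

open Complex Matrix Polynomial

/-! ### The matrix system in the (2+3)-dimensional case -/

/-- `H(Z) = ½ Tr (Z⁺Z)² + Tr (A Z D Z⁺)` with `A = diag a`, `D = diag d`
(the complex number on the right is real). -/
noncomputable def matH (a : Fin 2 → ℝ) (d : Fin 3 → ℝ) (Z : Matrix (Fin 2) (Fin 3) ℂ) : ℝ :=
  ((1 / 2 : ℂ) * ((Zᴴ * Z) ^ 2).trace
    + (Matrix.diagonal (fun i => (a i : ℂ)) * Z
        * Matrix.diagonal (fun j => (d j : ℂ)) * Zᴴ).trace).re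

/-- The Wirtinger derivative `∂K/∂(conj Z_{ij}) = ½ (∂/∂x_{ij} + i ∂/∂y_{ij}) K`,
`Z_{ij} = x_{ij} + i y_{ij}`. -/
noncomputable def dConj (K : Matrix (Fin 2) (Fin 3) ℂ → ℝ) (Z : Matrix (Fin 2) (Fin 3) ℂ)
    (i : Fin 2) (j : Fin 3) : ℂ :=
  (1 / 2 : ℂ) * ((deriv (fun u : ℝ => K (Z + Matrix.single i j (u : ℂ))) 0 : ℝ)
    + I * (deriv (fun u : ℝ => K (Z + Matrix.single i j ((u : ℂ) * I))) 0 : ℝ))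

/-- Hamilton's equations `Ż = i ∂K/∂Z⁺` (the equation for `Z⁺` is the conjugate one). -/
def IsMatTrajectory (K : Matrix (Fin 2) (Fin 3) ℂ → ℝ)
    (Z : ℝ → Matrix (Fin 2) (Fin 3) ℂ) : Prop :=
  ∀ t i j, HasDerivAt (fun u => Z u i j) (I * dConj K (Z t) i j) t

/-- `s_k = |z_k|² + |v_k|²`, where `z`, `v` are the rows of `Z`. -/
noncomputable def sOf (Z : Matrix (Fin 2) (Fin 3) ℂ) (k : Fin 3) : ℝ :=
  ‖Z 0 k‖ ^ 2 + ‖Z 1 k‖ ^ 2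

/-- `(r_k, η_k) = (|z_k|² - |v_k|², conj v_k * z_k)`. -/
noncomputable def rEta (Z : Matrix (Fin 2) (Fin 3) ℂ) (k : Fin 3) : ℝ × ℂ :=
  (‖Z 0 k‖ ^ 2 - ‖Z 1 k‖ ^ 2, (starRingEnd ℂ) (Z 1 k) * Z 0 k)

/-! ### The leaf `S² × S²` and its Poisson bracket -/

/-- Points `(r_1, η_1, r_2, η_2)`; index `0` is the first mode and index `1` the second. -/
abbrev Space : Type := Fin 2 → ℝ × ℂ

/-- The leaf `S²_{s_1} × S²_{s_2}`, each sphere being `r_k² + (2|η_k|)² = s_k²`. -/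
def leaf (s : Fin 2 → ℝ) : Set Space :=
  {x | ∀ k, (x k).1 ^ 2 + (2 * ‖(x k).2‖) ^ 2 = s k ^ 2}

/-- The derivative of `f` at `x` in the direction `v` of the `k`-th factor. -/
noncomputable def dDir (f : Space → ℂ) (x : Space) (k : Fin 2) (v : ℝ × ℂ) : ℂ :=
  deriv (fun u : ℝ => f (x + Pi.single k (u • v))) 0

noncomputable def dR (f : Space → ℂ) (x : Space) (k : Fin 2) : ℂ := dDir f x k (1, 0)

noncomputable def dEta (f : Space → ℂ) (x : Space) (k : Fin 2) : ℂ :=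
  (1 / 2 : ℂ) * (dDir f x k (0, 1) - I * dDir f x k (0, I))

noncomputable def dEtaBar (f : Space → ℂ) (x : Space) (k : Fin 2) : ℂ :=
  (1 / 2 : ℂ) * (dDir f x k (0, 1) + I * dDir f x k (0, I))

/-- The Poisson bracket of the symplectic form `dr_1 ∧ dφ_1 + dr_2 ∧ dφ_2`,
`φ_k = arg η_k`: it is fixed by `{r_k, η_k} = i η_k`, `{η_k, conj η_k} = i r_k / 2`. -/
noncomputable def bracket (f g : Space → ℂ) (x : Space) : ℂ :=
  (1 / 2 : ℂ) * I * ∑ k : Fin 2,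
    (((x k).1 : ℂ) * (dEta f x k * dEtaBar g x k - dEtaBar f x k * dEta g x k)
      + 2 * (x k).2 * (dR f x k * dEta g x k - dEta f x k * dR g x k)
      + 2 * (starRingEnd ℂ) (x k).2 * (dEtaBar f x k * dR g x k - dR f x k * dEtaBar g x k))

/-- `x` is, on the time set `J`, a solution in the leaf of `ṙ_k = {r_k, K}`, `η̇_k = {η_k, K}`. -/
def IsLeafTrajectory (s : Fin 2 → ℝ) (K : Space → ℝ) (J : Set ℝ) (x : ℝ → Space) : Prop :=
  ∀ t ∈ J, x t ∈ leaf s ∧ ∀ k,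
    HasDerivAt (fun u => ((x u k).1 : ℂ))
      (bracket (fun y => ((y k).1 : ℂ)) (fun y => (K y : ℂ)) (x t)) t ∧
    HasDerivAt (fun u => (x u k).2)
      (bracket (fun y => (y k).2) (fun y => (K y : ℂ)) (x t)) t

/-- The Hamiltonian `H` for `s_3 = 0`. -/
noncomputable def leafH (a : Fin 2 → ℝ) (d : Fin 3 → ℝ) (s : Fin 2 → ℝ) (x : Space) : ℝ :=
  ‖(x 0).2 + (x 1).2‖ ^ 2 + 1 / 4 * ((x 0).1 + (x 1).1) ^ 2
    + 1 / 2 * (a 0 - a 1) * (d 0 * (x 0).1 + d 1 * (x 1).1)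
    + 1 / 4 * (s 0 + s 1) ^ 2 + 1 / 2 * (a 0 + a 1) * (d 0 * s 0 + d 1 * s 1)

/-- `R = r_1 + r_2`. -/
def leafR (x : Space) : ℝ := (x 0).1 + (x 1).1

/-- The coordinates `(r_k, φ_k)`: `η_k = ½ √(s_k² - r_k²) e^{i φ_k}`. -/
noncomputable def polar (s q φ : Fin 2 → ℝ) : Space := fun k =>
  (q k, ((1 / 2 * Real.sqrt (s k ^ 2 - q k ^ 2) : ℝ) : ℂ) * exp ((φ k : ℂ) * I))

/-! ### Reduction by the flow of `R` -/

/-- `σ_φ`: `(r_1, r_2, φ_1, φ_2) ↦ (r_1, r_2, φ_1 + φ, φ_2 + φ)`. -/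
noncomputable def rFlow (φ : ℝ) (x : Space) : Space := fun k =>
  ((x k).1, exp ((φ : ℂ) * I) * (x k).2)

theorem rFlow_zero (x : Space) : rFlow 0 x = x := by
  funext k; simp [rFlow]

theorem rFlow_add (φ χ : ℝ) (x : Space) : rFlow (φ + χ) x = rFlow φ (rFlow χ x) := by
  funext k
  simp [rFlow, add_mul, Complex.exp_add, mul_assoc]

/-- Two points are equivalent if they lie on the same orbit of the flow. -/
def orbitSetoid : Setoid Space where
  r x y := ∃ φ : ℝ, rFlow φ x = y
  iseqv :=
    { refl := fun x => ⟨0, rFlow_zero x⟩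
      symm := by
        rintro x y ⟨φ, rfl⟩
        exact ⟨-φ, by rw [← rFlow_add, neg_add_cancel, rFlow_zero]⟩
      trans := by
        rintro x y z ⟨φ, rfl⟩ ⟨χ, rfl⟩
        exact ⟨χ + φ, rFlow_add χ φ x⟩ }

/-- The orbit of a point. -/
def orbit (x : Space) : Quotient orbitSetoid := Quotient.mk orbitSetoid x

theorem leafH_rFlow (a : Fin 2 → ℝ) (d : Fin 3 → ℝ) (s : Fin 2 → ℝ) (φ : ℝ) (x : Space) :
    leafH a d s (rFlow φ x) = leafH a d s x := by
  simp [leafH, rFlow, ← mul_add, Complex.norm_exp_ofReal_mul_I]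

/-- The function induced by `H` on the space of orbits. -/
noncomputable def orbitH (a : Fin 2 → ℝ) (d : Fin 3 → ℝ) (s : Fin 2 → ℝ) :
    Quotient orbitSetoid → ℝ :=
  Quotient.lift (leafH a d s) (by
    rintro x y ⟨φ, rfl⟩
    exact (leafH_rFlow a d s φ x).symm)

/-- The part of the reduced phase space `R⁻¹(r)/σ` on which `η_1, η_2 ≠ 0`. -/
def reducedRegular (s : Fin 2 → ℝ) (r : ℝ) : Set (Quotient orbitSetoid) :=
  orbit '' {x | x ∈ leaf s ∧ leafR x = r ∧ ∀ k, (x k).2 ≠ 0}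

/-- The range of `r_1` on the regular part of the reduced phase space. -/
def reducedRange (s : Fin 2 → ℝ) (r : ℝ) : Set ℝ := {q | |q| < s 0 ∧ |r - q| < s 1}

/-- The point with coordinates `r_1 = q`, `r_2 = r - q`, `φ_1 = ψ`, `φ_2 = 0`. -/
noncomputable def slice (s : Fin 2 → ℝ) (r q ψ : ℝ) : Space := polar s ![q, r - q] ![ψ, 0]

/-- The orbit with coordinates `r_1 = q` and `ψ_1 = φ_1 - φ_2 = ψ`. -/
noncomputable def reducedChart (s : Fin 2 → ℝ) (r q ψ : ℝ) : Quotient orbitSetoid :=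
  orbit (slice s r q ψ)

/-- The polynomial `w_2`. -/
noncomputable def w2 (a : Fin 2 → ℝ) (d : Fin 3 → ℝ) (s : Fin 2 → ℝ) (r : ℝ) : ℝ[X] :=
  -C (1 / 4) * (X ^ 2 + (C r - X) ^ 2) + C (1 / 4 * (s 0 ^ 2 + s 1 ^ 2)) + C (1 / 4 * r ^ 2)
    + C (1 / 2 * (a 0 - a 1)) * (C (d 0) * X + C (d 1) * (C r - X))
    + C (1 / 4 * (s 0 + s 1) ^ 2) + C (1 / 2 * (a 0 + a 1) * (d 0 * s 0 + d 1 * s 1))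

/-- The polynomial `(s_1² - r_1²)(s_2² - (r - r_1)²)` in `r_1`. -/
noncomputable def radicand (s : Fin 2 → ℝ) (r : ℝ) : ℝ[X] :=
  (C (s 0 ^ 2) - X ^ 2) * (C (s 1 ^ 2) - (C r - X) ^ 2)

/-- The polynomial `w_4`, for the value `h` of `H`. -/
noncomputable def w4 (a : Fin 2 → ℝ) (d : Fin 3 → ℝ) (s : Fin 2 → ℝ) (r h : ℝ) : ℝ[X] :=
  radicand s r - 4 * (C h - w2 a d s r) ^ 2

/-- The reduced Hamiltonian as a function of `(r_1, ψ_1) = (q, ψ)`. -/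
noncomputable def reducedH (a : Fin 2 → ℝ) (d : Fin 3 → ℝ) (s : Fin 2 → ℝ) (r q ψ : ℝ) : ℝ :=
  1 / 2 * Real.sqrt ((radicand s r).eval q) * Real.cos ψ + (w2 a d s r).eval q

/-- Hamilton's equations `q̇ = {q, K} = ∂K/∂ψ`, `ψ̇ = {ψ, K} = -∂K/∂q` for `dq ∧ dψ`. -/
def IsCanonicalSolution (K : ℝ → ℝ → ℝ) (J : Set ℝ) (q ψ : ℝ → ℝ) : Prop :=
  ∀ t ∈ J, HasDerivAt q (deriv (fun p => K (q t) p) (ψ t)) t ∧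
    HasDerivAt ψ (-deriv (fun y => K y (ψ t)) (q t)) t

/-- Elliptic functions: meromorphic on `ℂ` with two periods independent over `ℝ`. -/
def IsElliptic (f : ℂ → ℂ) : Prop :=
  (∀ z, MeromorphicAt f z) ∧
    ∃ p₁ p₂ : ℂ, LinearIndependent ℝ ![p₁, p₂] ∧ ∀ z, f (z + p₁) = f z ∧ f (z + p₂) = f z

end NWave

open NWave

namespace NWave

open Complex Matrix Polynomial ComplexConjugate

/-! ### Directional derivatives and the bracket -/

/-! Everything after the matrix system is governed by the rotation-invariant quantity w = η₁ conj
η₂. On the leaf, the sphere equations turn H into 2 Re w + w₂(r₁) (`leafH_of_mem_leaf`) and give 16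
|w|² = (s₁² - r₁²)(s₂² - (r - r₁)²) (`normSq_mul_conj`), while the equations of motion give ṙ₁ = -2
Im w. Eliminating Re w and Im w yields 4 ṙ₁² = w₄(r₁).

The matrix statement rests on the gradient ZZ⁺Z + AZD (`dConj_matH`): each column moves by a
Hermitian matrix times i, which conserves its norm, and with the third column zero the quantities
r_k, η_k satisfy the leaf equations up to a factor -2 in time.

For the reduction, (r₁, r₂, w) separates the orbits of σ where η₁, η₂ ≠ 0, and there w has modulus
determined by r₁ and argument ψ₁ (`bijOn_reducedChart`). The reduced bracket follows from the
canonical one because invariant functions satisfy ∂/∂φ₁ + ∂/∂φ₂ = 0 (`bracket_slice`). A leaf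
trajectory projects to a reduced one by differentiating log w; conversely a reduced solution is
lifted by finding φ₂ through a quadrature (`IsCanonicalSolution.exists_isLeafTrajectory`).

For the solution, the integral formula is the substitution q = r₁(t) in 2 dq / √w₄(q). Ellipticity
cannot be read from the first-order equation alone, since uniqueness fails at turning points. The
trajectory also satisfies the Newton equation r̈₁ = w₄'(r₁)/8 at all times
(`IsLeafTrajectory.hasDerivAt_velocity`), where uniqueness holds (`newton_unique`). Since |r₁| ≤ s₁
and w₄(±s₁) ≤ 0, the motion lies between two real roots of the cubic, so all three roots are real;
then α + (β - α) sn²(ωt + c) solves the same Newton equation, and c can be fitted to the initial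
data (`exists_isElliptic_of_roots`). The function sn is built by inverting the elliptic integral on
the real line and extended to ℂ by the addition theorem; its meromorphy and two periods are checked
directly (`complexSn_meromorphicAt`, `complexSn_add_real`, `complexSn_add_imag`). -/

theorem hasDerivAt_line (x : Space) (k : Fin 2) (v : ℝ × ℂ) :
    HasDerivAt (fun u : ℝ => x + Pi.single k (u • v)) (Pi.single k v : Space) 0 := by
  have h : HasDerivAt (fun u : ℝ => x + u • (Pi.single k v : Space))
      ((1 : ℝ) • (Pi.single k v : Space)) 0 :=
    ((hasDerivAt_id (0 : ℝ)).smul_const _).const_add x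
  rw [one_smul] at h
  refine h.congr_of_eventuallyEq (Filter.Eventually.of_forall fun u => ?_)
  simp only [Pi.single_smul]

theorem dDir_eq {f : Space → ℂ} {x : Space} {f' : Space →L[ℝ] ℂ} (hf : HasFDerivAt f f' x)
    (k : Fin 2) (v : ℝ × ℂ) : dDir f x k v = f' (Pi.single k v) := by
  have h0 : x + Pi.single k ((0 : ℝ) • v) = x := by simp
  exact ((h0.symm ▸ hf : HasFDerivAt f f' (x + Pi.single k ((0 : ℝ) • v))).comp_hasDerivAt
    (0 : ℝ) (hasDerivAt_line x k v)).deriv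

theorem dDir_ofReal {f : Space → ℝ} {x : Space} (hf : DifferentiableAt ℝ f x)
    (k : Fin 2) (v : ℝ × ℂ) :
    dDir (fun y => (f y : ℂ)) x k v = (fderiv ℝ f x (Pi.single k v) : ℝ) := by
  have h0 : x + Pi.single k ((0 : ℝ) • v) = x := by simp
  have := ((h0.symm ▸ hf.hasFDerivAt :
    HasFDerivAt f (fderiv ℝ f x) (x + Pi.single k ((0 : ℝ) • v))).comp_hasDerivAt
    (0 : ℝ) (hasDerivAt_line x k v))
  exact this.ofReal_comp.deriv

/-- `leafH` and `leafR` have degree at most two along the coordinate lines used below, so their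
derivatives are read off as linear coefficients. -/
theorem dDir_of_quadratic {f : Space → ℝ} {x : Space} {k : Fin 2} {v : ℝ × ℂ} {A B : ℝ}
    (h : ∀ u : ℝ, f (x + Pi.single k (u • v)) = f x + u * A + u ^ 2 * B) :
    dDir (fun y => (f y : ℂ)) x k v = A := by
  have h1 : HasDerivAt (fun u : ℝ => f (x + Pi.single k (u • v))) A 0 := by
    simp only [h]
    have := (((hasDerivAt_id (0 : ℝ)).mul_const A).const_add (f x)).add
      (((hasDerivAt_id (0 : ℝ)).pow 2).mul_const B)
    exact this.congr_deriv (by simp)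
  exact h1.ofReal_comp.deriv

theorem hasFDerivAt_fst (x : Space) (k : Fin 2) :
    HasFDerivAt (fun y : Space => ((y k).1 : ℂ))
      (ofRealCLM ∘L ContinuousLinearMap.fst ℝ ℝ ℂ ∘L
        ContinuousLinearMap.proj (R := ℝ) (φ := fun _ : Fin 2 => ℝ × ℂ) k) x :=
  ContinuousLinearMap.hasFDerivAt
    (ofRealCLM ∘L ContinuousLinearMap.fst ℝ ℝ ℂ ∘L
        ContinuousLinearMap.proj (R := ℝ) (φ := fun _ : Fin 2 => ℝ × ℂ) k)

theorem hasFDerivAt_snd (x : Space) (k : Fin 2) :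
    HasFDerivAt (fun y : Space => (y k).2)
      (ContinuousLinearMap.snd ℝ ℝ ℂ ∘L
        ContinuousLinearMap.proj (R := ℝ) (φ := fun _ : Fin 2 => ℝ × ℂ) k) x :=
  ContinuousLinearMap.hasFDerivAt
    (ContinuousLinearMap.snd ℝ ℝ ℂ ∘L
        ContinuousLinearMap.proj (R := ℝ) (φ := fun _ : Fin 2 => ℝ × ℂ) k)

/-- The derivatives of a coordinate are constants, so the sum collapses to a single mode. Together
with `bracket_snd` this makes the equations of motion explicit; η is complex, so `bracket_ofReal`
would not suffice. -/
theorem bracket_fst (K : Space → ℂ) (x : Space) (k : Fin 2) :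
    bracket (fun y => ((y k).1 : ℂ)) K x
      = I * ((x k).2 * dEta K x k - conj (x k).2 * dEtaBar K x k) := by
  rw [bracket, Fin.sum_univ_two]
  generalize hE : dEta K x = E
  generalize hB : dEtaBar K x = B
  simp only [dEta, dEtaBar, dR, dDir_eq (hasFDerivAt_fst x k)]
  fin_cases k <;> simp <;> ring

theorem bracket_snd (K : Space → ℂ) (x : Space) (k : Fin 2) :
    bracket (fun y => (y k).2) K x
      = I / 2 * ((x k).1 * dEtaBar K x k - 2 * (x k).2 * dR K x k) := by
  rw [bracket, Fin.sum_univ_two]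
  generalize hE : dEta K x = E
  generalize hB : dEtaBar K x = B
  generalize hC : dR K x = C
  simp only [dEta, dEtaBar, dR, dDir_eq (hasFDerivAt_snd x k)]
  fin_cases k <;> simp <;> ring

/-! ### Canonical coordinates -/

/-- The bracket of real functions in terms of their real partial derivatives. -/
theorem bracket_ofReal {f g : Space → ℝ} {x : Space} (hf : DifferentiableAt ℝ f x)
    (hg : DifferentiableAt ℝ g x) :
    bracket (fun y => (f y : ℂ)) (fun y => (g y : ℂ)) x =
      ((∑ k, (
        fderiv ℝ f x (Pi.single k (1, 0)) *
          ((x k).2.re * fderiv ℝ g x (Pi.single k (0, I))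
            - (x k).2.im * fderiv ℝ g x (Pi.single k (0, 1)))
        - fderiv ℝ g x (Pi.single k (1, 0)) *
          ((x k).2.re * fderiv ℝ f x (Pi.single k (0, I))
            - (x k).2.im * fderiv ℝ f x (Pi.single k (0, 1)))
        - (x k).1 / 4 * (fderiv ℝ f x (Pi.single k (0, 1)) * fderiv ℝ g x (Pi.single k (0, I))
            - fderiv ℝ f x (Pi.single k (0, I)) * fderiv ℝ g x (Pi.single k (0, 1)))) : ℝ) : ℂ) := by
  rw [bracket, Finset.mul_sum, ofReal_sum]
  refine Finset.sum_congr rfl fun k _ => ?_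
  simp only [dEta, dEtaBar, dR, dDir_ofReal hf, dDir_ofReal hg]
  generalize fderiv ℝ f x (Pi.single k (1, 0)) = fr
  generalize fderiv ℝ f x (Pi.single k (0, 1)) = fx
  generalize fderiv ℝ f x (Pi.single k (0, I)) = fy
  generalize fderiv ℝ g x (Pi.single k (1, 0)) = gr
  generalize fderiv ℝ g x (Pi.single k (0, 1)) = gx
  generalize fderiv ℝ g x (Pi.single k (0, I)) = gy
  apply Complex.ext
  · simp; ring
  · simp; ring

theorem fderiv_single_eq (L : Space →L[ℝ] ℝ) (k : Fin 2) (p : ℝ) (w : ℂ) :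
    L (Pi.single k (p, w)) = p * L (Pi.single k (1, 0)) + w.re * L (Pi.single k (0, 1))
      + w.im * L (Pi.single k (0, I)) := by
  have : (Pi.single k (p, w) : Space) = p • (Pi.single k ((1 : ℝ), (0 : ℂ)) : Space)
      + w.re • (Pi.single k ((0 : ℝ), (1 : ℂ)) : Space)
      + w.im • (Pi.single k ((0 : ℝ), I) : Space) := by
    rw [← Pi.single_smul, ← Pi.single_smul, ← Pi.single_smul, ← Pi.single_add, ← Pi.single_add]
    congr 1
    ext <;> simp
  rw [this]
  simp

theorem hasDerivAt_update_space {F : ℝ → Space} {u : ℝ} {k : Fin 2} {p : ℝ × ℂ}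
    (hk : HasDerivAt (fun v => F v k) p u) (hj : ∀ j ≠ k, ∀ v, F v j = F u j) :
    HasDerivAt F (Pi.single k p) u := by
  rw [hasDerivAt_pi]
  intro j
  by_cases h : j = k
  · subst h; simpa using hk
  · simp only [hj j h, Pi.single_eq_of_ne h]
    exact hasDerivAt_const _ _

theorem hasDerivAt_radius {s q : ℝ} (h : |q| < s) :
    HasDerivAt (fun u => 1 / 2 * Real.sqrt (s ^ 2 - u ^ 2))
      (-q / (2 * Real.sqrt (s ^ 2 - q ^ 2))) q := by
  have h0 : 0 < s ^ 2 - q ^ 2 := by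
    have := sq_lt_sq' (by linarith [abs_lt.1 h]) (abs_lt.1 h).2
    linarith
  have h1 : HasDerivAt (fun u : ℝ => s ^ 2 - u ^ 2) (-(2 * q)) q := by
    simpa using ((hasDerivAt_id q).pow 2).const_sub (s ^ 2)
  have := (h1.sqrt h0.ne').const_mul (1 / 2)
  exact this.congr_deriv (by ring)

theorem hasDerivAt_polar_q {s q φ : Fin 2 → ℝ} {k : Fin 2} (h : |q k| < s k) :
    HasDerivAt (fun u => polar s (Function.update q k u) φ)
      (Pi.single k (1, ((-q k / (2 * Real.sqrt (s k ^ 2 - q k ^ 2)) : ℝ) : ℂ)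
        * exp ((φ k : ℂ) * I))) (q k) := by
  refine hasDerivAt_update_space ?_ ?_
  · have h1 := (hasDerivAt_radius h).ofReal_comp.mul_const (exp ((φ k : ℂ) * I))
    have := (hasDerivAt_id (q k)).prodMk h1
    simpa [polar] using this
  · intro j hj v
    simp [polar, Function.update_of_ne hj]

theorem hasDerivAt_polar_phi (s q φ : Fin 2 → ℝ) (k : Fin 2) :
    HasDerivAt (fun u => polar s q (Function.update φ k u))
      (Pi.single k (0, I * (polar s q φ k).2)) (φ k) := by
  refine hasDerivAt_update_space ?_ ?_
  · have h1 : HasDerivAt (fun u : ℝ => exp ((u : ℂ) * I)) (exp ((φ k : ℂ) * I) * (1 * I)) (φ k) :=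
      (((hasDerivAt_id (φ k)).ofReal_comp).mul_const I).cexp
    have := (hasDerivAt_const (φ k) (q k)).prodMk
      (h1.const_mul ((1 / 2 * Real.sqrt (s k ^ 2 - q k ^ 2) : ℝ) : ℂ))
    convert this using 2
    · ext <;> simp [polar]
    · simp [polar]; ring
  · intro j hj v
    simp [polar, Function.update_of_ne hj]

theorem deriv_comp_space {f : Space → ℝ} {F : ℝ → Space} {u : ℝ} {v : Space} {x : Space}
    (hx : F u = x) (hf : DifferentiableAt ℝ f x) (hF : HasDerivAt F v u) :
    deriv (fun w => f (F w)) u = fderiv ℝ f x v := by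
  subst hx
  exact (hf.hasFDerivAt.comp_hasDerivAt u hF).deriv

theorem bracket_polar {s : Fin 2 → ℝ} {f g : Space → ℝ} {q φ : Fin 2 → ℝ}
    (hf : DifferentiableAt ℝ f (polar s q φ)) (hg : DifferentiableAt ℝ g (polar s q φ))
    (hq : ∀ k, |q k| < s k) :
    bracket (fun y => (f y : ℂ)) (fun y => (g y : ℂ)) (polar s q φ) =
          ((∑ k, (deriv (fun u => f (polar s (Function.update q k u) φ)) (q k)
                * deriv (fun u => g (polar s q (Function.update φ k u))) (φ k)
              - deriv (fun u => f (polar s q (Function.update φ k u))) (φ k)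
                * deriv (fun u => g (polar s (Function.update q k u) φ)) (q k)) : ℝ) : ℂ) := by
  rw [bracket_ofReal hf hg]
  congr 1
  refine Finset.sum_congr rfl fun k _ => ?_
  have e1 : polar s (Function.update q k (q k)) φ = polar s q φ := by simp
  have e2 : polar s q (Function.update φ k (φ k)) = polar s q φ := by simp
  rw [deriv_comp_space e1 hf (hasDerivAt_polar_q (hq k)),
    deriv_comp_space e1 hg (hasDerivAt_polar_q (hq k)),
    deriv_comp_space e2 hf (hasDerivAt_polar_phi s q φ k),
    deriv_comp_space e2 hg (hasDerivAt_polar_phi s q φ k)]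
  rw [fderiv_single_eq (fderiv ℝ f _) k 1 (_ * _), fderiv_single_eq (fderiv ℝ f _) k 0 (_ * _),
    fderiv_single_eq (fderiv ℝ g _) k 1 (_ * _), fderiv_single_eq (fderiv ℝ g _) k 0 (_ * _)]
  generalize fderiv ℝ f (polar s q φ) (Pi.single k (1, 0)) = fr
  generalize fderiv ℝ f (polar s q φ) (Pi.single k (0, 1)) = fx
  generalize fderiv ℝ f (polar s q φ) (Pi.single k (0, I)) = fy
  generalize fderiv ℝ g (polar s q φ) (Pi.single k (1, 0)) = gr
  generalize fderiv ℝ g (polar s q φ) (Pi.single k (0, 1)) = gx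
  generalize fderiv ℝ g (polar s q φ) (Pi.single k (0, I)) = gy
  have h0 : 0 < s k ^ 2 - q k ^ 2 := by
    have := sq_lt_sq' (by linarith [abs_lt.1 (hq k)]) (abs_lt.1 (hq k)).2
    linarith
  have hS : Real.sqrt (s k ^ 2 - q k ^ 2) ≠ 0 := (Real.sqrt_pos.2 h0).ne'
  have hc := Real.sin_sq_add_cos_sq (φ k)
  simp only [polar, Complex.mul_re, Complex.mul_im, ofReal_re, ofReal_im, I_re, I_im,
    exp_ofReal_mul_I_re, exp_ofReal_mul_I_im]
  generalize Real.sqrt (s k ^ 2 - q k ^ 2) = S at *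
  field_simp
  -- The radius S/2 times its q-derivative -q/(2S) is -q/4, which reproduces the r_k/4 term of the
  -- bracket; what remains is sin² + cos² = 1.
  linear_combination (4 * S * q k * (fx * gy - fy * gx)) * hc

/-! ### Hamiltonian equations on the leaf -/

theorem dDir_leafH_fst (a : Fin 2 → ℝ) (d : Fin 3 → ℝ) (s : Fin 2 → ℝ) (x : Space) (k : Fin 2) :
    dDir (fun y => (leafH a d s y : ℂ)) x k (1, 0)
      = ((1 / 2 * leafR x + 1 / 2 * (a 0 - a 1) * d k.castSucc : ℝ) : ℂ) := by
  refine dDir_of_quadratic (B := 1 / 4) fun u => ?_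
  fin_cases k <;> simp [leafH, leafR] <;> ring

theorem dDir_leafH_snd (a : Fin 2 → ℝ) (d : Fin 3 → ℝ) (s : Fin 2 → ℝ) (x : Space) (k : Fin 2)
    (w : ℂ) :
    dDir (fun y => (leafH a d s y : ℂ)) x k (0, w)
      = ((2 * (w * conj ((x 0).2 + (x 1).2)).re : ℝ) : ℂ) := by
  refine dDir_of_quadratic (B := ‖w‖ ^ 2) fun u => ?_
  fin_cases k <;> simp [leafH, Complex.sq_norm, Complex.normSq_apply] <;> ring

theorem isLeafTrajectory_leafH_iff (a : Fin 2 → ℝ) (d : Fin 3 → ℝ) (s : Fin 2 → ℝ) (J : Set ℝ)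
    (x : ℝ → Space) :
    IsLeafTrajectory s (leafH a d s) J x ↔ ∀ t ∈ J, x t ∈ leaf s ∧ ∀ k,
      HasDerivAt (fun u => (x u k).1) (-2 * ((x t k).2 * conj ((x t 0).2 + (x t 1).2)).im) t ∧
      HasDerivAt (fun u => (x u k).2) (I / 2 * ((x t k).1 * ((x t 0).2 + (x t 1).2)
        - ((leafR (x t) + (a 0 - a 1) * d k.castSucc : ℝ) : ℂ) * (x t k).2)) t := by
  have hE : ∀ y k, dEta (fun y => (leafH a d s y : ℂ)) y k = conj ((y 0).2 + (y 1).2) := by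
    intro y k
    rw [dEta, dDir_leafH_snd, dDir_leafH_snd]
    apply Complex.ext <;> simp
  have hB : ∀ y k, dEtaBar (fun y => (leafH a d s y : ℂ)) y k = (y 0).2 + (y 1).2 := by
    intro y k
    rw [dEtaBar, dDir_leafH_snd, dDir_leafH_snd]
    apply Complex.ext <;> simp
    ring
  have h1 : ∀ y k, bracket (fun y => ((y k).1 : ℂ)) (fun y => (leafH a d s y : ℂ)) y
      = ((-2 * ((y k).2 * conj ((y 0).2 + (y 1).2)).im : ℝ) : ℂ) := by
    intro y k
    rw [bracket_fst, hE, hB]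
    apply Complex.ext <;> simp <;> ring
  have h2 : ∀ y k, bracket (fun y => (y k).2) (fun y => (leafH a d s y : ℂ)) y
      = I / 2 * ((y k).1 * ((y 0).2 + (y 1).2)
        - ((leafR y + (a 0 - a 1) * d k.castSucc : ℝ) : ℂ) * (y k).2) := by
    intro y k
    rw [bracket_snd, hB, dR, dDir_leafH_fst]
    push_cast
    ring
  simp only [IsLeafTrajectory, h1, h2]
  refine forall₂_congr fun t _ => and_congr_right fun _ => forall_congr' fun k =>
    and_congr_left fun _ => ⟨fun h => ?_, fun h => h.ofReal_comp⟩
  exact (reCLM.hasFDerivAt.comp_hasDerivAt t h).congr_deriv (ofReal_re _)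

theorem leafR_trajectory_iff (s : Fin 2 → ℝ) (J : Set ℝ) (x : ℝ → Space) :
    IsLeafTrajectory s leafR J x ↔ ∀ t ∈ J, x t ∈ leaf s ∧ ∀ k,
      HasDerivAt (fun u => ((x u k).1 : ℂ)) 0 t ∧
      HasDerivAt (fun u => (x u k).2) (-I * (x t k).2) t := by
  have h1 : ∀ y k, dDir (fun y => (leafR y : ℂ)) y k (1, 0) = ((1 : ℝ) : ℂ) := by
    intro y k
    refine dDir_of_quadratic (B := 0) fun u => ?_
    fin_cases k <;> simp [leafR] <;> ring
  have h2 : ∀ y k w, dDir (fun y => (leafR y : ℂ)) y k (0, w) = ((0 : ℝ) : ℂ) := by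
    intro y k w
    refine dDir_of_quadratic (B := 0) fun u => ?_
    fin_cases k <;> simp [leafR]
  have h3 : ∀ y k, bracket (fun y => ((y k).1 : ℂ)) (fun y => (leafR y : ℂ)) y = 0 := by
    intro y k
    rw [bracket_fst, dEta, dEtaBar, h2, h2]
    simp
  have h4 : ∀ y k, bracket (fun y => (y k).2) (fun y => (leafR y : ℂ)) y = -I * (y k).2 := by
    intro y k
    rw [bracket_snd, dEtaBar, dR, h1, h2, h2]
    push_cast
    ring
  simp only [IsLeafTrajectory, h3, h4]

theorem rFlow_mem_leaf {s : Fin 2 → ℝ} {x : Space} (hx : x ∈ leaf s) (φ : ℝ) :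
    rFlow φ x ∈ leaf s := by
  intro k
  have := hx k
  simpa [rFlow, Complex.norm_exp_ofReal_mul_I] using this

theorem hasDerivAt_exp_mul (c : ℂ) (t : ℝ) :
    HasDerivAt (fun u : ℝ => exp ((u : ℂ) * c)) (exp ((t : ℂ) * c) * c) t := by
  simpa using (((hasDerivAt_id t).ofReal_comp).mul_const c).cexp

theorem isLeafTrajectory_leafR_iff (s : Fin 2 → ℝ) (x : ℝ → Space) :
    IsLeafTrajectory s leafR Set.univ x ↔
      x 0 ∈ leaf s ∧ ∀ t, x t = rFlow (-t) (x 0) := by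
  rw [leafR_trajectory_iff]
  constructor
  · intro h
    refine ⟨(h 0 trivial).1, fun t => ?_⟩
    funext k
    have h1 : ((x t k).1 : ℂ) = (x 0 k).1 :=
      is_const_of_deriv_eq_zero (𝕜 := ℝ) (f := fun u => ((x u k).1 : ℂ))
        (fun u => (((h u trivial).2 k).1).differentiableAt)
        (fun u => (((h u trivial).2 k).1).deriv) t 0
    -- Integrating factor: η̇ = -iη makes e^{it} η constant.
    have h2 : ∀ u : ℝ, HasDerivAt (fun u : ℝ => exp ((u : ℂ) * I) * (x u k).2) 0 u := by
      intro u
      exact ((hasDerivAt_exp_mul I u).mul ((h u trivial).2 k).2).congr_deriv (by ring)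
    have h3 : exp ((t : ℂ) * I) * (x t k).2 = exp (((0 : ℝ) : ℂ) * I) * (x 0 k).2 :=
      is_const_of_deriv_eq_zero (𝕜 := ℝ) (f := fun u : ℝ => exp ((u : ℂ) * I) * (x u k).2)
        (fun u => (h2 u).differentiableAt) (fun u => (h2 u).deriv) t 0
    refine Prod.ext (by exact_mod_cast h1) ?_
    simp only [ofReal_zero, zero_mul, Complex.exp_zero, one_mul] at h3
    simp only [rFlow, ofReal_neg, neg_mul, ← h3, ← mul_assoc, ← Complex.exp_add]
    simp
  · rintro ⟨h0, h⟩ t -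
    refine ⟨h t ▸ rFlow_mem_leaf h0 _, fun k => ⟨?_, ?_⟩⟩
    · have : (fun u => ((x u k).1 : ℂ)) = fun _ => ((x 0 k).1 : ℂ) := by
        funext u; rw [h u]; simp [rFlow]
      rw [this]
      exact hasDerivAt_const _ _
    · have : (fun u => (x u k).2) = fun u : ℝ => exp ((u : ℂ) * -I) * (x 0 k).2 := by
        funext u; rw [h u]; simp [rFlow]
      rw [this]
      exact ((hasDerivAt_exp_mul (-I) t).mul_const (x 0 k).2).congr_deriv
        (by rw [h t]; simp [rFlow]; ring)

/-! ### The matrix system -/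

/-- Along a line, H is the real part of a polynomial of degree four in u. Its linear coefficient
contains W and W⁺; taking adjoints under the trace preserves real parts, so the W⁺ terms fold onto
the W terms and produce the factor 2. -/
theorem hasDerivAt_matH_line (a : Fin 2 → ℝ) (d : Fin 3 → ℝ) (Z W : Matrix (Fin 2) (Fin 3) ℂ) :
    HasDerivAt (fun u : ℝ => matH a d (Z + (u : ℂ) • W))
      (2 * ((Zᴴ * Z * Zᴴ + Matrix.diagonal (fun j => (d j : ℂ)) * Zᴴ
        * Matrix.diagonal (fun i => (a i : ℂ))) * W).trace.re) 0 := by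
  set A : Matrix (Fin 2) (Fin 2) ℂ := Matrix.diagonal (fun i => (a i : ℂ)) with hA
  set D : Matrix (Fin 3) (Fin 3) ℂ := Matrix.diagonal (fun j => (d j : ℂ)) with hD
  have hAA : Aᴴ = A := by
    rw [hA, Matrix.diagonal_conjTranspose]; congr 1; funext i; simp
  have hDD : Dᴴ = D := by
    rw [hD, Matrix.diagonal_conjTranspose]; congr 1; funext i; simp
  set T := Zᴴ * Z
  set M := Wᴴ * Z + Zᴴ * W
  set N := Wᴴ * W
  have key : ∀ u : ℝ, (1 / 2 : ℂ) * (((Z + (u : ℂ) • W)ᴴ * (Z + (u : ℂ) • W)) ^ 2).trace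
      + (A * (Z + (u : ℂ) • W) * D * (Z + (u : ℂ) • W)ᴴ).trace
      = ((1 / 2 : ℂ) * (T ^ 2).trace + (A * Z * D * Zᴴ).trace)
        + (u : ℂ) * ((T * M).trace + (A * W * D * Zᴴ).trace + (A * Z * D * Wᴴ).trace)
        + (u : ℂ) ^ 2 * ((1 / 2 : ℂ) * ((M * M).trace + 2 * (T * N).trace)
            + (A * W * D * Wᴴ).trace)
        + (u : ℂ) ^ 3 * (M * N).trace + (u : ℂ) ^ 4 * ((1 / 2 : ℂ) * (N * N).trace) := by
    intro u
    have e1 : (Z + (u : ℂ) • W)ᴴ = Zᴴ + (u : ℂ) • Wᴴ := by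
      rw [conjTranspose_add, conjTranspose_smul]; simp
    have e2 : (Zᴴ + (u : ℂ) • Wᴴ) * (Z + (u : ℂ) • W)
        = T + (u : ℂ) • M + (u : ℂ) ^ 2 • N := by
      simp only [Matrix.add_mul, Matrix.mul_add, Matrix.smul_mul, Matrix.mul_smul, smul_smul,
        smul_add, T, M, N, pow_two]
      abel
    rw [e1, e2]
    simp only [pow_two (T + _ + _), pow_two T, Matrix.add_mul, Matrix.mul_add, Matrix.smul_mul,
      Matrix.mul_smul, trace_add, trace_smul, smul_eq_mul]
    rw [trace_mul_comm M T, trace_mul_comm N T, trace_mul_comm N M]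
    ring
  have hre : ∀ X : Matrix (Fin 3) (Fin 3) ℂ, Xᴴ.trace.re = X.trace.re := by
    intro X; rw [trace_conjTranspose]; simp
  have hlin : ((T * M).trace + (A * W * D * Zᴴ).trace + (A * Z * D * Wᴴ).trace).re
      = 2 * ((Zᴴ * Z * Zᴴ + D * Zᴴ * A) * W).trace.re := by
    have t1 : (T * (Wᴴ * Z)).trace.re = (Zᴴ * Z * Zᴴ * W).trace.re := by
      rw [← hre, conjTranspose_mul, conjTranspose_mul, conjTranspose_conjTranspose,
        conjTranspose_mul, conjTranspose_conjTranspose, trace_mul_comm]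
      simp only [Matrix.mul_assoc]
    have t2 : (A * W * D * Zᴴ).trace = (D * Zᴴ * A * W).trace := by
      rw [Matrix.mul_assoc (A * W), trace_mul_comm]
      simp only [Matrix.mul_assoc]
    have t3 : (A * Z * D * Wᴴ).trace.re = (D * Zᴴ * A * W).trace.re := by
      rw [trace_mul_comm, ← hre]
      simp only [conjTranspose_mul, conjTranspose_conjTranspose, hAA, hDD, Matrix.mul_assoc]
    simp only [M, Matrix.mul_add, Matrix.add_mul, trace_add, add_re, t1, t2, t3]
    simp only [T, Matrix.mul_assoc]
    ring
  have hd : HasDerivAt (fun u : ℝ => (1 / 2 : ℂ) *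
      (((Z + (u : ℂ) • W)ᴴ * (Z + (u : ℂ) • W)) ^ 2).trace
      + (A * (Z + (u : ℂ) • W) * D * (Z + (u : ℂ) • W)ᴴ).trace)
      ((T * M).trace + (A * W * D * Zᴴ).trace + (A * Z * D * Wᴴ).trace) 0 := by
    simp only [key]
    have hu : HasDerivAt (fun u : ℝ => (u : ℂ)) 1 0 := by
      simpa using (hasDerivAt_id (0 : ℝ)).ofReal_comp
    refine (((((hu.mul_const _).const_add _).add ((hu.pow 2).mul_const _)).add
      ((hu.pow 3).mul_const _)).add ((hu.pow 4).mul_const _)).congr_deriv ?_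
    simp
  exact (reCLM.hasFDerivAt.comp_hasDerivAt (0 : ℝ) hd).congr_deriv hlin

/-- The differential of H is W ↦ 2 Re Tr(G⁺W) with G = ZZ⁺Z + AZD. Testing it on a matrix unit and
on i times that unit recovers an entry of G. -/
theorem dConj_matH (a : Fin 2 → ℝ) (d : Fin 3 → ℝ) (Z : Matrix (Fin 2) (Fin 3) ℂ)
    (i : Fin 2) (j : Fin 3) :
    dConj (matH a d) Z i j = ∑ k, (∑ l, Z i l * conj (Z k l)) * Z k j + a i * Z i j * d j := by
  have hs : ∀ (w : ℂ) (u : ℝ), Matrix.single i j ((u : ℂ) * w) = (u : ℂ) • Matrix.single i j w := by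
    intro w u; rw [Matrix.smul_single, smul_eq_mul]
  have h1 : ∀ w : ℂ, deriv (fun u : ℝ => matH a d (Z + Matrix.single i j ((u : ℂ) * w))) 0
      = 2 * (conj (∑ k, (∑ l, Z i l * conj (Z k l)) * Z k j + a i * Z i j * d j) * w).re := by
    intro w
    simp only [hs]
    rw [(hasDerivAt_matH_line a d Z (Matrix.single i j w)).deriv, Matrix.trace_mul_single]
    congr 2
    simp [Matrix.mul_apply, Matrix.diagonal_apply, Fin.sum_univ_succ]
    ring
  have h2 := h1 1
  simp only [mul_one] at h2
  rw [dConj, h2, h1 I]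
  generalize ∑ k, (∑ l, Z i l * conj (Z k l)) * Z k j + a i * Z i j * d j = X
  apply Complex.ext <;> simp

theorem ofReal_sOf (Z : Matrix (Fin 2) (Fin 3) ℂ) (k : Fin 3) :
    (sOf Z k : ℂ) = Z 0 k * conj (Z 0 k) + Z 1 k * conj (Z 1 k) := by
  simp only [sOf, ofReal_add, ofReal_pow, Complex.mul_conj']

theorem ofReal_rEta_fst (Z : Matrix (Fin 2) (Fin 3) ℂ) (k : Fin 3) :
    ((rEta Z k).1 : ℂ) = Z 0 k * conj (Z 0 k) - Z 1 k * conj (Z 1 k) := by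
  simp only [rEta, ofReal_sub, ofReal_pow, Complex.mul_conj']

section Trajectory

variable {a : Fin 2 → ℝ} {d : Fin 3 → ℝ} {Z : ℝ → Matrix (Fin 2) (Fin 3) ℂ}

theorem IsMatTrajectory.hasDerivAt (hZ : IsMatTrajectory (matH a d) Z) (t : ℝ) (i : Fin 2)
    (j : Fin 3) :
    HasDerivAt (fun u => Z u i j)
      (I * (∑ k, (∑ l, Z t i l * conj (Z t k l)) * Z t k j + a i * Z t i j * d j)) t :=
  dConj_matH a d (Z t) i j ▸ hZ t i j

theorem IsMatTrajectory.hasDerivAt_conj (hZ : IsMatTrajectory (matH a d) Z) (t : ℝ) (i : Fin 2)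
    (j : Fin 3) :
    HasDerivAt (fun u => conj (Z u i j))
      (-I * (∑ k, (∑ l, conj (Z t i l) * Z t k l) * conj (Z t k j)
        + a i * conj (Z t i j) * d j)) t :=
  ((hZ.hasDerivAt t i j).star).congr_deriv (by simp [Fin.sum_univ_succ])

/-- Column k obeys ż = iMz with M = ZZ⁺ + d_k A Hermitian, so its norm is conserved. -/
theorem IsMatTrajectory.sOf_eq (hZ : IsMatTrajectory (matH a d) Z) (t : ℝ) (k : Fin 3) :
    sOf (Z t) k = sOf (Z 0) k := by
  have h : ∀ u, HasDerivAt (fun u => (sOf (Z u) k : ℂ)) 0 u := by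
    intro u
    simp only [ofReal_sOf]
    refine (((hZ.hasDerivAt u 0 k).mul (hZ.hasDerivAt_conj u 0 k)).add
      ((hZ.hasDerivAt u 1 k).mul (hZ.hasDerivAt_conj u 1 k))).congr_deriv ?_
    simp only [Fin.sum_univ_two, Fin.sum_univ_three]
    ring
  exact_mod_cast is_const_of_deriv_eq_zero (𝕜 := ℝ) (f := fun u => (sOf (Z u) k : ℂ))
    (fun u => (h u).differentiableAt) (fun u => (h u).deriv) t 0

theorem eq_zero_of_sOf_eq_zero {Y : Matrix (Fin 2) (Fin 3) ℂ} {k : Fin 3} (h : sOf Y k = 0)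
    (i : Fin 2) : Y i k = 0 := by
  have h0 := sq_nonneg ‖Y 0 k‖
  have h1 := sq_nonneg ‖Y 1 k‖
  rw [sOf] at h
  fin_cases i
  · exact norm_eq_zero.1 (pow_eq_zero_iff two_ne_zero |>.1 (by linarith : ‖Y 0 k‖ ^ 2 = 0))
  · exact norm_eq_zero.1 (pow_eq_zero_iff two_ne_zero |>.1 (by linarith : ‖Y 1 k‖ ^ 2 = 0))

theorem rEta_sphere (Y : Matrix (Fin 2) (Fin 3) ℂ) (k : Fin 3) :
    (rEta Y k).1 ^ 2 + (2 * ‖(rEta Y k).2‖) ^ 2 = sOf Y k ^ 2 := by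
  simp only [rEta, sOf, norm_mul, RCLike.norm_conj]
  ring

theorem matH_eq_leafH {s : Fin 2 → ℝ} {Y : Matrix (Fin 2) (Fin 3) ℂ}
    (h0 : sOf Y 0 = s 0) (h1 : sOf Y 1 = s 1) (h2 : sOf Y 2 = 0) :
    matH a d Y = leafH a d s (fun k => rEta Y k.castSucc) := by
  have z0 := eq_zero_of_sOf_eq_zero h2 0
  have z1 := eq_zero_of_sOf_eq_zero h2 1
  simp [matH, leafH, rEta, ← h0, ← h1, sOf, Matrix.trace_fin_three, Matrix.trace_fin_two,
    pow_two (Yᴴ * Y), Matrix.mul_apply, Fin.sum_univ_three, Fin.sum_univ_two, z0, z1,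
    Matrix.diagonal_apply, Complex.sq_norm, Complex.normSq_apply]
  ring

/-- Along Z the rates of r_k and η_k are -2 times those prescribed by the bracket; the substitution
t ↦ -t/2 compensates exactly. The vanishing third column removes its contribution to ZZ⁺. -/
theorem IsMatTrajectory.isLeafTrajectory {s : Fin 2 → ℝ} (hZ : IsMatTrajectory (matH a d) Z)
    (h0 : sOf (Z 0) 0 = s 0) (h1 : sOf (Z 0) 1 = s 1) (h2 : sOf (Z 0) 2 = 0) :
    IsLeafTrajectory s (leafH a d s) Set.univ
      (fun t k => rEta (Z (-t / 2)) k.castSucc) := by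
  rw [isLeafTrajectory_leafH_iff]
  rintro t -
  refine ⟨fun k => ?_, fun k => ?_⟩
  · simp only
    rw [rEta_sphere, hZ.sOf_eq]
    fin_cases k
    · simp [← h0]
    · simp [← h1]
  set τ := -t / 2 with hτ
  have hlin : HasDerivAt (fun u : ℝ => -u / 2) (-1 / 2) t :=
    ((hasDerivAt_id t).neg).div_const 2
  have z : ∀ i, Z τ i 2 = 0 := eq_zero_of_sOf_eq_zero (by rw [hZ.sOf_eq, h2])
  constructor
  · have hr : HasDerivAt (fun u => ((rEta (Z u) k.castSucc).1 : ℂ))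
        (((4 * ((rEta (Z τ) k.castSucc).2 * conj ((rEta (Z τ) 0).2
          + (rEta (Z τ) 1).2)).im : ℝ) : ℂ)) τ := by
      simp only [ofReal_rEta_fst]
      refine (((hZ.hasDerivAt τ 0 k.castSucc).mul (hZ.hasDerivAt_conj τ 0 k.castSucc)).sub
        ((hZ.hasDerivAt τ 1 k.castSucc).mul (hZ.hasDerivAt_conj τ 1 k.castSucc))).congr_deriv ?_
      simp only [Fin.sum_univ_two, Fin.sum_univ_three, rEta, z]
      apply Complex.ext
      · simp; ring
      · simp; ring
    have := (reCLM.hasFDerivAt.comp_hasDerivAt τ hr).scomp t hlin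
    refine this.congr_deriv ?_
    simp [rEta, hτ]; ring
  · have hr : HasDerivAt (fun u => (rEta (Z u) k.castSucc).2)
        (-I * ((rEta (Z τ) k.castSucc).1 * ((rEta (Z τ) 0).2 + (rEta (Z τ) 1).2)
        - (((rEta (Z τ) 0).1 + (rEta (Z τ) 1).1 + (a 0 - a 1) * d k.castSucc : ℝ) : ℂ)
          * (rEta (Z τ) k.castSucc).2)) τ := by
      simp only [ofReal_add, ofReal_rEta_fst]
      refine ((hZ.hasDerivAt_conj τ 1 k.castSucc).mul (hZ.hasDerivAt τ 0 k.castSucc)).congr_deriv ?_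
      simp only [Fin.sum_univ_two, Fin.sum_univ_three, rEta, z]
      push_cast
      simp only [map_zero]
      ring
    have := hr.scomp t hlin
    refine this.congr_deriv ?_
    simp only [Complex.real_smul, leafR, Fin.castSucc_zero,
      show (1 : Fin 2).castSucc = (1 : Fin 3) from rfl]
    push_cast
    ring

end Trajectory

theorem matrix_system (a : Fin 2 → ℝ) (d : Fin 3 → ℝ) (s : Fin 2 → ℝ)
    (Z : ℝ → Matrix (Fin 2) (Fin 3) ℂ) (hZ : IsMatTrajectory (matH a d) Z) :
      (∀ t k, sOf (Z t) k = sOf (Z 0) k) ∧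
      (sOf (Z 0) 0 = s 0 → sOf (Z 0) 1 = s 1 → sOf (Z 0) 2 = 0 →
        (∀ t, rEta (Z t) 2 = 0 ∧
          matH a d (Z t) = leafH a d s (fun k => rEta (Z t) k.castSucc)) ∧
        IsLeafTrajectory s (leafH a d s) Set.univ
          (fun t k => rEta (Z (-t / 2)) k.castSucc)) := by
  refine ⟨hZ.sOf_eq, fun h0 h1 h2 => ⟨fun t => ⟨?_, ?_⟩, hZ.isLeafTrajectory h0 h1 h2⟩⟩
  · have z : ∀ i, Z t i 2 = 0 := eq_zero_of_sOf_eq_zero (by rw [hZ.sOf_eq, h2])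
    simp [rEta, z]
  · exact matH_eq_leafH (by rw [hZ.sOf_eq, h0]) (by rw [hZ.sOf_eq, h1]) (by rw [hZ.sOf_eq, h2])

/-! ### Polar coordinates and orbits -/

theorem sq_sub_sq_pos {s q : ℝ} (h : |q| < s) : 0 < s ^ 2 - q ^ 2 := by
  have := sq_lt_sq' (by linarith [abs_lt.1 h]) (abs_lt.1 h).2
  linarith

theorem polar_mem_leaf {s q : Fin 2 → ℝ} (hq : ∀ k, |q k| < s k) (φ : Fin 2 → ℝ) :
    polar s q φ ∈ leaf s := by
  intro k
  have h := Real.sq_sqrt (sq_sub_sq_pos (hq k)).le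
  simp only [polar, norm_mul, Complex.norm_exp_ofReal_mul_I, mul_one, norm_real, Real.norm_eq_abs,
    mul_pow, sq_abs]
  linarith

theorem polar_snd_ne_zero {s q : Fin 2 → ℝ} {k : Fin 2} (hq : |q k| < s k) (φ : Fin 2 → ℝ) :
    (polar s q φ k).2 ≠ 0 := by
  have h := Real.sqrt_pos.2 (sq_sub_sq_pos hq)
  refine mul_ne_zero ?_ (Complex.exp_ne_zero _)
  exact_mod_cast (by positivity : 1 / 2 * Real.sqrt (s k ^ 2 - q k ^ 2) ≠ 0)

theorem norm_snd_of_mem_leaf {s : Fin 2 → ℝ} {x : Space} (hx : x ∈ leaf s) (k : Fin 2) :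
    ‖(x k).2‖ = 1 / 2 * Real.sqrt (s k ^ 2 - (x k).1 ^ 2) := by
  have h : s k ^ 2 - (x k).1 ^ 2 = (2 * ‖(x k).2‖) ^ 2 := by linarith [hx k]
  rw [h, Real.sqrt_sq (by positivity)]
  ring

theorem abs_fst_lt_of_mem_leaf {s : Fin 2 → ℝ} (hs : ∀ k, 0 < s k) {x : Space} (hx : x ∈ leaf s)
    {k : Fin 2} (h : (x k).2 ≠ 0) : |(x k).1| < s k := by
  refine abs_lt_of_sq_lt_sq ?_ (hs k).le
  have := hx k
  have h2 : 0 < 2 * ‖(x k).2‖ := by positivity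
  nlinarith

theorem abs_fst_le_of_mem_leaf {s : Fin 2 → ℝ} (hs : ∀ k, 0 < s k) {x : Space} (hx : x ∈ leaf s)
    (k : Fin 2) : |(x k).1| ≤ s k := by
  refine abs_le_of_sq_le_sq ?_ (hs k).le
  have := hx k
  nlinarith [sq_nonneg (2 * ‖(x k).2‖)]

theorem eq_polar_of_mem_leaf {s : Fin 2 → ℝ} {x : Space} (hx : x ∈ leaf s) :
    x = polar s (fun k => (x k).1) (fun k => (x k).2.arg) := by
  funext k
  refine Prod.ext rfl ?_
  simp only [polar, ← norm_snd_of_mem_leaf hx k, Complex.norm_mul_exp_arg_mul_I]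

theorem rFlow_polar (s q φ : Fin 2 → ℝ) (χ : ℝ) :
    rFlow χ (polar s q φ) = polar s q (fun k => χ + φ k) := by
  funext k
  refine Prod.ext rfl ?_
  simp only [rFlow, polar, ofReal_add, add_mul, Complex.exp_add]
  ring

theorem polar_congr {s q φ χ : Fin 2 → ℝ}
    (h : ∀ k, exp ((φ k : ℂ) * I) = exp ((χ k : ℂ) * I)) : polar s q φ = polar s q χ := by
  funext k
  simp only [polar, h k]

theorem slice_congr {s : Fin 2 → ℝ} {r q ψ χ : ℝ} (h : exp ((ψ : ℂ) * I) = exp ((χ : ℂ) * I)) :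
    slice s r q ψ = slice s r q χ := by
  refine polar_congr fun k => ?_
  fin_cases k
  · simpa using h
  · simp

theorem orbit_eq_orbit_iff {x y : Space} : orbit x = orbit y ↔ ∃ φ : ℝ, rFlow φ x = y :=
  Quotient.eq

theorem orbit_rFlow (φ : ℝ) (x : Space) : orbit (rFlow φ x) = orbit x :=
  (orbit_eq_orbit_iff.2 ⟨φ, rfl⟩).symm

theorem orbit_polar (s q φ : Fin 2 → ℝ) {r : ℝ} (h : q 0 + q 1 = r) :
    orbit (polar s q φ) = reducedChart s r (q 0) (φ 0 - φ 1) := by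
  have h1 : ![q 0, r - q 0] = q := by
    funext k; fin_cases k
    · rfl
    · simp [← h]
  have h2 : ![φ 0 - φ 1, 0] = fun k => -φ 1 + φ k := by
    funext k; fin_cases k
    · simp; ring
    · simp
  rw [reducedChart, slice, h1, h2, ← rFlow_polar, orbit_rFlow]

section Range

variable {s : Fin 2 → ℝ} {r q : ℝ}

theorem radicand_eval (s : Fin 2 → ℝ) (r q : ℝ) :
    (radicand s r).eval q = (s 0 ^ 2 - q ^ 2) * (s 1 ^ 2 - (r - q) ^ 2) := by
  simp [radicand]

theorem w2_eval (a : Fin 2 → ℝ) (d : Fin 3 → ℝ) (s : Fin 2 → ℝ) (r q : ℝ) :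
    (w2 a d s r).eval q = -(1 / 4) * (q ^ 2 + (r - q) ^ 2) + 1 / 4 * (s 0 ^ 2 + s 1 ^ 2)
      + 1 / 4 * r ^ 2 + 1 / 2 * (a 0 - a 1) * (d 0 * q + d 1 * (r - q))
      + 1 / 4 * (s 0 + s 1) ^ 2 + 1 / 2 * (a 0 + a 1) * (d 0 * s 0 + d 1 * s 1) := by
  simp only [w2, eval_add, eval_mul, eval_neg, eval_C, eval_sub, eval_pow, eval_X]

theorem abs_slice_lt (hq : q ∈ reducedRange s r) (k : Fin 2) :
    |(![q, r - q] : Fin 2 → ℝ) k| < s k := by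
  fin_cases k
  · exact hq.1
  · exact hq.2

theorem sqrt_radicand (hq : q ∈ reducedRange s r) :
    Real.sqrt ((radicand s r).eval q)
      = Real.sqrt (s 0 ^ 2 - q ^ 2) * Real.sqrt (s 1 ^ 2 - (r - q) ^ 2) := by
  rw [radicand_eval, Real.sqrt_mul (sq_sub_sq_pos hq.1).le]

theorem sqrt_radicand_pos (hq : q ∈ reducedRange s r) :
    0 < Real.sqrt ((radicand s r).eval q) := by
  rw [sqrt_radicand hq]
  exact mul_pos (Real.sqrt_pos.2 (sq_sub_sq_pos hq.1)) (Real.sqrt_pos.2 (sq_sub_sq_pos hq.2))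

theorem slice_mul_conj (hq : q ∈ reducedRange s r) (ψ : ℝ) :
    (slice s r q ψ 0).2 * conj (slice s r q ψ 1).2
      = ((1 / 4 * Real.sqrt ((radicand s r).eval q) : ℝ) : ℂ) * exp ((ψ : ℂ) * I) := by
  rw [sqrt_radicand hq]
  simp [slice, polar, Complex.conj_ofNat]
  ring

/-- The phase factor of a rotation cancels in η₁ conj η₂, so this product, like r₁ and r₂, depends
only on the orbit. -/
theorem of_orbit_eq_reducedChart {x : Space} {ψ : ℝ} (h : orbit x = reducedChart s r q ψ) :
    (x 0).1 = q ∧ (x 1).1 = r - q ∧ (x 0).2 * conj (x 1).2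
      = (slice s r q ψ 0).2 * conj (slice s r q ψ 1).2 := by
  obtain ⟨φ, hφ⟩ := orbit_eq_orbit_iff.1 h
  rw [← hφ]
  have h0 := congrArg (fun y : Space => (y 0).1) hφ
  have h1 := congrArg (fun y : Space => (y 1).1) hφ
  refine ⟨h0, h1, ?_⟩
  have : exp ((φ : ℂ) * I) * conj (exp ((φ : ℂ) * I)) = 1 := by
    rw [Complex.mul_conj', Complex.norm_exp_ofReal_mul_I]; simp
  simp only [rFlow, map_mul]
  linear_combination (-((x 0).2 * conj (x 1).2)) * this

theorem arg_exp_of_mem {θ : ℝ} (hθ : θ ∈ Set.Ioc (-Real.pi) Real.pi) :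
    (exp ((θ : ℂ) * I)).arg = θ := by
  rw [Complex.exp_mul_I]
  exact Complex.arg_cos_add_sin_mul_I hθ

theorem bijOn_reducedChart (hs : ∀ k, 0 < s k) (r : ℝ) :
    Set.BijOn (fun p : ℝ × ℝ => reducedChart s r p.1 p.2)
      (reducedRange s r ×ˢ Set.Ioc (-Real.pi) Real.pi) (reducedRegular s r) := by
  refine ⟨?_, ?_, ?_⟩
  · rintro ⟨q, ψ⟩ ⟨hq, -⟩
    refine ⟨slice s r q ψ, ⟨polar_mem_leaf (abs_slice_lt hq) _, ?_, fun k =>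
      polar_snd_ne_zero (abs_slice_lt hq k) _⟩, rfl⟩
    simp [leafR, slice, polar]
  · rintro ⟨q, ψ⟩ ⟨hq, hψ⟩ ⟨q', ψ'⟩ ⟨hq', hψ'⟩ h
    obtain ⟨h0, -, h2⟩ := of_orbit_eq_reducedChart (x := slice s r q ψ) h
    have h0' : q = q' := by simpa [slice, polar] using h0
    subst h0'
    rw [slice_mul_conj hq, slice_mul_conj hq] at h2
    have hne : ((1 / 4 * Real.sqrt ((radicand s r).eval q) : ℝ) : ℂ) ≠ 0 := by
      have := sqrt_radicand_pos hq
      exact_mod_cast (by positivity : 1 / 4 * Real.sqrt ((radicand s r).eval q) ≠ 0)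
    -- Equal invariants with the same positive modulus have equal arguments, and on (-π, π] the
    -- argument determines the angle.
    have h3 := congrArg Complex.arg (mul_left_cancel₀ hne h2)
    rw [arg_exp_of_mem hψ, arg_exp_of_mem hψ'] at h3
    exact Prod.ext rfl h3
  · rintro _ ⟨x, ⟨hx, hR, hne⟩, rfl⟩
    set θ := (x 0).2.arg - (x 1).2.arg
    have h1 : (x 1).1 = r - (x 0).1 := by rw [← hR, leafR]; ring
    -- The difference of two arguments may leave (-π, π]; the argument of e^{iθ} is its
    -- representative there.
    refine ⟨((x 0).1, (exp ((θ : ℂ) * I)).arg), ⟨⟨abs_fst_lt_of_mem_leaf hs hx (hne 0), ?_⟩,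
      Complex.arg_mem_Ioc _⟩, ?_⟩
    · rw [← h1]; exact abs_fst_lt_of_mem_leaf hs hx (hne 1)
    · have h2 : exp (((exp ((θ : ℂ) * I)).arg : ℂ) * I) = exp ((θ : ℂ) * I) := by
        have := Complex.norm_mul_exp_arg_mul_I (exp ((θ : ℂ) * I))
        rwa [Complex.norm_exp_ofReal_mul_I, ofReal_one, one_mul] at this
      have h3 := orbit_polar s (fun k => (x k).1) (fun k => (x k).2.arg) hR
      rw [← eq_polar_of_mem_leaf hx] at h3
      rw [h3]
      simp only [reducedChart, slice_congr h2]
      rfl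

theorem orbitH_reducedChart (a : Fin 2 → ℝ) (d : Fin 3 → ℝ) (hq : q ∈ reducedRange s r) (ψ : ℝ) :
    orbitH a d s (reducedChart s r q ψ) = reducedH a d s r q ψ := by
  change leafH a d s (slice s r q ψ) = _
  have h0 := Real.sq_sqrt (sq_sub_sq_pos hq.1).le
  have h1 := Real.sq_sqrt (sq_sub_sq_pos hq.2).le
  have hc := Real.sin_sq_add_cos_sq ψ
  rw [reducedH, sqrt_radicand hq, w2_eval]
  simp only [leafH, slice, polar, Complex.sq_norm, Complex.normSq_apply, Matrix.cons_val_zero,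
    Matrix.cons_val_one, Complex.add_re, Complex.add_im, Complex.mul_re, Complex.mul_im,
    ofReal_re, ofReal_im, exp_ofReal_mul_I_re, exp_ofReal_mul_I_im, Real.cos_zero, Real.sin_zero]
  linear_combination (1 / 4 * Real.sqrt (s 0 ^ 2 - q ^ 2) ^ 2) * hc + 1 / 4 * h0 + 1 / 4 * h1

end Range

/-! ### The reduced bracket -/

theorem hasDerivAt_polar {s : Fin 2 → ℝ} {q φ : ℝ → Fin 2 → ℝ} {k : Fin 2} {t q' φ' : ℝ}
    (h : |q t k| < s k) (hq : HasDerivAt (fun u => q u k) q' t)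
    (hφ : HasDerivAt (fun u => φ u k) φ' t) :
    HasDerivAt (fun u => polar s (q u) (φ u) k)
      (q', (((-q t k / (2 * Real.sqrt (s k ^ 2 - q t k ^ 2)) * q' : ℝ) : ℂ)
        + I * ((1 / 2 * Real.sqrt (s k ^ 2 - q t k ^ 2) * φ' : ℝ) : ℂ))
          * exp ((φ t k : ℂ) * I)) t := by
  have h1 : HasDerivAt (fun u => 1 / 2 * Real.sqrt (s k ^ 2 - q u k ^ 2))
      (-q t k / (2 * Real.sqrt (s k ^ 2 - q t k ^ 2)) * q') t :=
    HasDerivAt.comp (h₂ := fun u => 1 / 2 * Real.sqrt (s k ^ 2 - u ^ 2)) t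
      (hasDerivAt_radius h) hq
  have h2 : HasDerivAt (fun u => exp ((φ u k : ℂ) * I)) (exp ((φ t k : ℂ) * I) * (φ' * I)) t :=
    (hφ.ofReal_comp.mul_const I).cexp
  refine (hq.prodMk (h1.ofReal_comp.mul h2)).congr_deriv (Prod.ext rfl ?_)
  push_cast
  ring

theorem hasDerivAt_rFlow (x : Space) :
    HasDerivAt (fun u => rFlow u x)
      ((Pi.single 0 (0, I * (x 0).2) : Space) + (Pi.single 1 (0, I * (x 1).2) : Space)) 0 := by
  rw [hasDerivAt_pi]
  intro k
  have h2 : HasDerivAt (fun u : ℝ => exp ((u : ℂ) * I)) (exp (((0 : ℝ) : ℂ) * I) * I) 0 :=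
    hasDerivAt_exp_mul I 0
  refine ((hasDerivAt_const (0 : ℝ) (x k).1).prodMk (h2.mul_const (x k).2)).congr_deriv ?_
  fin_cases k <;> simp

theorem bracket_slice {s : Fin 2 → ℝ} {r q ψ : ℝ} {f g : Space → ℝ}
    (hf : Differentiable ℝ f) (hg : Differentiable ℝ g)
    (hfi : ∀ φ x, f (rFlow φ x) = f x) (hgi : ∀ φ x, g (rFlow φ x) = g x)
    (hq : q ∈ reducedRange s r) :
    bracket (fun y => (f y : ℂ)) (fun y => (g y : ℂ)) (slice s r q ψ) =
      ((deriv (fun u => f (slice s r u ψ)) q * deriv (fun u => g (slice s r q u)) ψ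
        - deriv (fun u => f (slice s r q u)) ψ
          * deriv (fun u => g (slice s r u ψ)) q : ℝ) : ℂ) := by
  have hlt := abs_slice_lt hq
  set p : Fin 2 → ℝ := ![q, r - q]
  set χ : Fin 2 → ℝ := ![ψ, 0]
  set V : Fin 2 → Space := fun k =>
    Pi.single k (1, ((-p k / (2 * Real.sqrt (s k ^ 2 - p k ^ 2)) : ℝ) : ℂ)
        * exp ((χ k : ℂ) * I)) with hV
  have hx : slice s r q ψ = polar s p χ := rfl
  -- On the level R = r, increasing r₁ decreases r₂ at the same rate, hence the difference of the
  -- two radial directions.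
  have d1 : HasDerivAt (fun u => slice s r u ψ) (V 0 - V 1) q := by
    rw [hasDerivAt_pi]
    intro k
    have hk : HasDerivAt (fun u => (![u, r - u] : Fin 2 → ℝ) k) (![1, -1] k) q := by
      fin_cases k
      · exact hasDerivAt_id q
      · exact (hasDerivAt_id q).const_sub r
    refine (hasDerivAt_polar (s := s) (q := fun u => ![u, r - u]) (φ := fun _ => ![ψ, 0])
      (hlt k) hk (hasDerivAt_const _ _)).congr_deriv ?_
    fin_cases k <;> simp [hV, p, χ]
  have d2 : HasDerivAt (fun u => slice s r q u) (Pi.single 0 (0, I * (polar s p χ 0).2)) ψ := by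
    refine ((hasDerivAt_polar_phi s p χ 0).congr_deriv rfl).congr_of_eventuallyEq
      (Filter.Eventually.of_forall fun u => ?_)
    simp only [slice]
    congr 1
    funext k
    fin_cases k <;> simp [χ]
  -- An invariant function is constant along the simultaneous rotation, so its φ₂-derivative is
  -- minus its φ₁-derivative. This merges the two canonical pairs into the single pair (r₁, ψ₁).
  have hinv : ∀ {F : Space → ℝ}, Differentiable ℝ F → (∀ φ x, F (rFlow φ x) = F x) →
      fderiv ℝ F (polar s p χ) (Pi.single 1 (0, I * (polar s p χ 1).2))
        = - fderiv ℝ F (polar s p χ) (Pi.single 0 (0, I * (polar s p χ 0).2)) := by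
    intro F hF hFi
    have h1 := deriv_comp_space (F := fun u => rFlow u (polar s p χ)) (rFlow_zero _)
      (hF (polar s p χ)) (hasDerivAt_rFlow (polar s p χ))
    simp only [hFi, deriv_const, map_add] at h1
    linarith
  have e1 : ∀ k, polar s (Function.update p k (p k)) χ = polar s p χ := by simp
  have e2 : ∀ k, polar s p (Function.update χ k (χ k)) = polar s p χ := by simp
  have c1 : ∀ {F : Space → ℝ}, Differentiable ℝ F → deriv (fun u => F (slice s r u ψ)) q
      = fderiv ℝ F (polar s p χ) (V 0 - V 1) := fun hF =>
    deriv_comp_space (F := fun u => slice s r u ψ) hx (hF _) d1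
  have c2 : ∀ {F : Space → ℝ}, Differentiable ℝ F → deriv (fun u => F (slice s r q u)) ψ
      = fderiv ℝ F (polar s p χ) (Pi.single 0 (0, I * (polar s p χ 0).2)) := fun hF =>
    deriv_comp_space (F := fun u => slice s r q u) hx (hF _) d2
  have c3 : ∀ {F : Space → ℝ}, Differentiable ℝ F → ∀ k,
      deriv (fun u => F (polar s (Function.update p k u) χ)) (p k)
        = fderiv ℝ F (polar s p χ) (V k) := fun hF k =>
    deriv_comp_space (F := fun u => polar s (Function.update p k u) χ) (e1 k) (hF _)
      (hasDerivAt_polar_q (hlt k))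
  have c4 : ∀ {F : Space → ℝ}, Differentiable ℝ F → ∀ k,
      deriv (fun u => F (polar s p (Function.update χ k u))) (χ k)
        = fderiv ℝ F (polar s p χ) (Pi.single k (0, I * (polar s p χ k).2)) := fun hF k =>
    deriv_comp_space (F := fun u => polar s p (Function.update χ k u)) (e2 k) (hF _)
      (hasDerivAt_polar_phi s p χ k)
  rw [hx, bracket_polar (hf _) (hg _) hlt, c1 hf, c1 hg, c2 hf, c2 hg, Fin.sum_univ_two]
  simp only [c3 hf, c3 hg, c4 hf, c4 hg, hinv hf hfi, hinv hg hgi, map_sub]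
  congr 1
  ring

/-! ### The reduced equations of motion -/

/-- Differentiability of a continuous angle. -/
theorem hasDerivAt_angle {ψ : ℝ → ℝ} {w : ℝ → ℂ} {w' : ℂ} {t : ℝ} (hψ : ContinuousAt ψ t)
    (hw : HasDerivAt w w' t)
    (h : ∀ᶠ u in nhds t, ∃ ρ : ℝ, 0 < ρ ∧ w u = ρ * exp ((ψ u : ℂ) * I)) :
    HasDerivAt ψ (w' / w t).im t := by
  obtain ⟨ρ₀, hρ₀, hw₀⟩ := h.self_of_nhds
  have hne : w t ≠ 0 := by
    rw [hw₀]; exact mul_ne_zero (by exact_mod_cast hρ₀.ne') (Complex.exp_ne_zero _)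
  have h1 : HasDerivAt (fun u => w u / w t) (w' / w t) t := hw.div_const _
  -- Dividing by w(t) moves the base point to 1, inside the domain of the principal logarithm,
  -- whatever the value of ψ(t).
  have h2 : HasDerivAt (fun u => Complex.log (w u / w t)) (w' / w t / (w t / w t)) t :=
    h1.clog_real (by rw [div_self hne]; exact Complex.one_mem_slitPlane)
  have h3 : HasDerivAt (fun u => ψ t + (Complex.log (w u / w t)).im) (w' / w t).im t := by
    refine ((imCLM.hasFDerivAt.comp_hasDerivAt t h2).const_add (ψ t)).congr_deriv ?_
    rw [div_self hne, div_one]; rfl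
  refine h3.congr_of_eventuallyEq ?_
  -- Continuity of ψ excludes jumps by 2π, so near t the principal argument of the quotient is
  -- exactly ψ(u) - ψ(t).
  have hnear : ∀ᶠ u in nhds t, |ψ u - ψ t| < Real.pi := by
    have : Filter.Tendsto (fun u => |ψ u - ψ t|) (nhds t) (nhds |ψ t - ψ t|) :=
      (hψ.sub continuousAt_const).abs
    rw [sub_self, abs_zero] at this
    exact this.eventually (gt_mem_nhds Real.pi_pos)
  filter_upwards [h, hnear] with u ⟨ρ, hρ, hu⟩ hlt
  have e : w u / w t = ((ρ / ρ₀ : ℝ) : ℂ) * exp (((ψ u - ψ t : ℝ) : ℂ) * I) := by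
    rw [hu, hw₀, ofReal_sub, sub_mul, Complex.exp_sub]
    push_cast
    field_simp
  rw [e, Complex.log_im, Complex.arg_real_mul _ (by positivity), arg_exp_of_mem
    ⟨by linarith [abs_lt.1 hlt], (abs_lt.1 hlt).2.le⟩]
  ring

section

variable (a : Fin 2 → ℝ) (d : Fin 3 → ℝ) {s : Fin 2 → ℝ} {r q : ℝ}

theorem deriv_reducedH_angle (ψ : ℝ) :
    deriv (fun p => reducedH a d s r q p) ψ
      = -(1 / 2 * Real.sqrt ((radicand s r).eval q) * Real.sin ψ) := by
  have := ((Real.hasDerivAt_cos ψ).const_mul (1 / 2 * Real.sqrt ((radicand s r).eval q))).add_const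
    ((w2 a d s r).eval q)
  exact (this.congr_deriv (by ring)).deriv

theorem hasDerivAt_w2 :
    HasDerivAt (fun y => (w2 a d s r).eval y)
      (1 / 2 * (r - 2 * q) + 1 / 2 * (a 0 - a 1) * (d 0 - d 1)) q := by
  refine ((w2 a d s r).hasDerivAt q).congr_deriv ?_
  simp [w2, derivative_pow]
  ring

theorem hasDerivAt_radicand :
    HasDerivAt (fun y => (radicand s r).eval y)
      (2 * (r - q) * (s 0 ^ 2 - q ^ 2) - 2 * q * (s 1 ^ 2 - (r - q) ^ 2)) q := by
  refine ((radicand s r).hasDerivAt q).congr_deriv ?_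
  simp [radicand, derivative_pow]
  ring

theorem deriv_reducedH_fst (hq : q ∈ reducedRange s r) (ψ : ℝ) :
    deriv (fun y => reducedH a d s r y ψ) q
      = ((r - q) * (s 0 ^ 2 - q ^ 2) - q * (s 1 ^ 2 - (r - q) ^ 2))
          / (2 * Real.sqrt ((radicand s r).eval q)) * Real.cos ψ
        + (1 / 2 * (r - 2 * q) + 1 / 2 * (a 0 - a 1) * (d 0 - d 1)) := by
  have hpos := Real.sqrt_pos.1 (sqrt_radicand_pos hq)
  have h1 := ((((hasDerivAt_radicand (s := s) (r := r) (q := q)).sqrt hpos.ne').const_mul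
    (1 / 2)).mul_const (Real.cos ψ)).add (hasDerivAt_w2 a d (s := s) (r := r) (q := q))
  refine (h1.congr_deriv ?_).deriv
  have := (sqrt_radicand_pos hq).ne'
  field_simp

end

section

variable {a : Fin 2 → ℝ} {d : Fin 3 → ℝ} {s : Fin 2 → ℝ} {r : ℝ} {J : Set ℝ} {x : ℝ → Space}

theorem IsLeafTrajectory.hasDerivAt_fst_zero (hx : IsLeafTrajectory s (leafH a d s) J x) {t : ℝ}
    (ht : t ∈ J) :
    HasDerivAt (fun u => (x u 0).1) (-2 * ((x t 0).2 * conj (x t 1).2).im) t := by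
  refine ((((isLeafTrajectory_leafH_iff a d s J x).1 hx t ht).2 0).1).congr_deriv ?_
  simp; ring

theorem IsLeafTrajectory.hasDerivAt_fst_one (hx : IsLeafTrajectory s (leafH a d s) J x) {t : ℝ}
    (ht : t ∈ J) :
    HasDerivAt (fun u => (x u 1).1) (2 * ((x t 0).2 * conj (x t 1).2).im) t := by
  refine ((((isLeafTrajectory_leafH_iff a d s J x).1 hx t ht).2 1).1).congr_deriv ?_
  simp; ring

theorem IsLeafTrajectory.hasDerivAt_mul_conj (hx : IsLeafTrajectory s (leafH a d s) J x) {t : ℝ}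
    (ht : t ∈ J) :
    HasDerivAt (fun u => (x u 0).2 * conj (x u 1).2)
      (I / 2 * ((((x t 0).1 - (x t 1).1 - (a 0 - a 1) * (d 0 - d 1) : ℝ) : ℂ)
          * ((x t 0).2 * conj (x t 1).2)
        + (((x t 0).1 * ‖(x t 1).2‖ ^ 2 - (x t 1).1 * ‖(x t 0).2‖ ^ 2 : ℝ) : ℂ))) t := by
  have h := ((isLeafTrajectory_leafH_iff a d s J x).1 hx t ht).2
  refine ((h 0).2.mul (h 1).2.star).congr_deriv ?_
  push_cast
  simp only [← Complex.mul_conj', leafR, RCLike.star_def, map_mul, map_sub, map_add, map_div₀,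
    conj_ofReal, conj_I, Complex.conj_ofNat, ofReal_add]
  ring

theorem IsLeafTrajectory.isCanonicalSolution (hx : IsLeafTrajectory s (leafH a d s) J x)
    {q ψ : ℝ → ℝ} (hJ : IsOpen J) (hq : ∀ t ∈ J, q t ∈ reducedRange s r) (hψ : ContinuousOn ψ J)
    (h : ∀ t ∈ J, orbit (x t) = reducedChart s r (q t) (ψ t)) :
    IsCanonicalSolution (reducedH a d s r) J q ψ := by
  intro t ht
  have hw : ∀ u ∈ J, (x u 0).2 * conj (x u 1).2
      = ((1 / 4 * Real.sqrt ((radicand s r).eval (q u)) : ℝ) : ℂ) * exp ((ψ u : ℂ) * I) :=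
    fun u hu => (of_orbit_eq_reducedChart (h u hu)).2.2.trans (slice_mul_conj (hq u hu) _)
  have hJt : J ∈ nhds t := hJ.mem_nhds ht
  obtain ⟨e0, e1, -⟩ := of_orbit_eq_reducedChart (h t ht)
  have hleaf := (hx t ht).1
  have hSp := sqrt_radicand_pos (hq t ht)
  constructor
  · refine ((hx.hasDerivAt_fst_zero ht).congr_of_eventuallyEq ?_).congr_deriv ?_
    · filter_upwards [hJt] with u hu
      exact (of_orbit_eq_reducedChart (h u hu)).1.symm
    · rw [deriv_reducedH_angle, hw t ht, Complex.im_ofReal_mul, exp_ofReal_mul_I_im]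
      ring
  · refine (hasDerivAt_angle (hψ.continuousAt hJt) (hx.hasDerivAt_mul_conj ht) ?_).congr_deriv ?_
    · filter_upwards [hJt] with u hu
      have := sqrt_radicand_pos (hq u hu)
      exact ⟨_, by positivity, hw u hu⟩
    · have n0 : ‖(x t 0).2‖ ^ 2 = 1 / 4 * (s 0 ^ 2 - q t ^ 2) := by
        have := hleaf 0
        rw [e0] at this
        linarith
      have n1 : ‖(x t 1).2‖ ^ 2 = 1 / 4 * (s 1 ^ 2 - (r - q t) ^ 2) := by
        have := hleaf 1
        rw [e1] at this
        linarith
      rw [deriv_reducedH_fst a d (hq t ht), hw t ht, n0, n1, e0, e1]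
      set S := Real.sqrt ((radicand s r).eval (q t))
      have hSc : (S : ℂ) ≠ 0 := by exact_mod_cast hSp.ne'
      have hinv : (exp ((ψ t : ℂ) * I))⁻¹ = exp (((-ψ t : ℝ) : ℂ) * I) := by
        rw [← Complex.exp_neg]; congr 1; push_cast; ring
      -- Since A and B are real, the angular velocity Im(ẇ/w) splits into a constant rotation A/2
      -- and a multiple of Re(1/w), which is where cos ψ enters.
      have key : ∀ A B : ℝ, (I / 2 * ((A : ℂ) * (((1 / 4 * S : ℝ) : ℂ) * exp ((ψ t : ℂ) * I)) + B)
          / (((1 / 4 * S : ℝ) : ℂ) * exp ((ψ t : ℂ) * I))).im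
            = A / 2 + 2 * B / S * Real.cos (ψ t) := by
        intro A B
        have : I / 2 * ((A : ℂ) * (((1 / 4 * S : ℝ) : ℂ) * exp ((ψ t : ℂ) * I)) + B)
          / (((1 / 4 * S : ℝ) : ℂ) * exp ((ψ t : ℂ) * I))
            = ((A / 2 : ℝ) : ℂ) * I + ((2 * B / S : ℝ) : ℂ) * (I * exp (((-ψ t : ℝ) : ℂ) * I)) := by
          rw [← hinv]
          push_cast
          field_simp
          ring
        rw [this, Complex.add_im, Complex.im_ofReal_mul, Complex.im_ofReal_mul, Complex.I_mul_im,
          exp_ofReal_mul_I_re, Real.cos_neg]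
        simp
      rw [key]
      field_simp
      ring

end

/-! ### Reconstruction of leaf trajectories from reduced solutions -/

theorem exists_hasDerivAt_of_continuousOn {J : Set ℝ} {g : ℝ → ℝ} (hJ : IsOpen J)
    (hJc : J.OrdConnected) (hg : ContinuousOn g J) : ∃ G : ℝ → ℝ, ∀ t ∈ J, HasDerivAt G (g t) t := by
  rcases J.eq_empty_or_nonempty with rfl | ⟨t₀, ht₀⟩
  · exact ⟨0, fun t ht => ht.elim⟩
  refine ⟨fun t => ∫ u in t₀..t, g u, fun t ht => ?_⟩
  exact intervalIntegral.integral_hasDerivAt_right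
    ((hg.mono (hJc.uIcc_subset ht₀ ht)).intervalIntegrable)
    (hg.stronglyMeasurableAtFilter hJ t ht) (hg.continuousAt (hJ.mem_nhds ht))

theorem IsCanonicalSolution.exists_isLeafTrajectory {a : Fin 2 → ℝ} {d : Fin 3 → ℝ}
    {s : Fin 2 → ℝ} {r : ℝ} {J : Set ℝ} {q ψ : ℝ → ℝ}
    (h : IsCanonicalSolution (reducedH a d s r) J q ψ) (hJ : IsOpen J) (hJc : J.OrdConnected)
    (hq : ∀ t ∈ J, q t ∈ reducedRange s r) :
    ∃ x : ℝ → Space, IsLeafTrajectory s (leafH a d s) J x ∧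
      ∀ t ∈ J, orbit (x t) = reducedChart s r (q t) (ψ t) := by
  have hqc : ContinuousOn q J := fun t ht => (h t ht).1.continuousAt.continuousWithinAt
  have hψc : ContinuousOn ψ J := fun t ht => (h t ht).2.continuousAt.continuousWithinAt
  have hne : ∀ t ∈ J, Real.sqrt (s 1 ^ 2 - (r - q t) ^ 2) ≠ 0 := fun t ht =>
    (Real.sqrt_pos.2 (sq_sub_sq_pos (hq t ht).2)).ne'
  -- The integrand is the angular velocity of φ₂ forced by the equation for η₂, written in r₁ and ψ₁
  -- alone. Its antiderivative G serves as φ₂, and ψ + G as φ₁.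
  obtain ⟨G, hG⟩ := exists_hasDerivAt_of_continuousOn hJ hJc (g := fun t =>
    -(1 / 2 * (r + (a 0 - a 1) * d 1)) + 1 / 2 * (r - q t) * (1 + Real.sqrt (s 0 ^ 2 - q t ^ 2)
      / Real.sqrt (s 1 ^ 2 - (r - q t) ^ 2) * Real.cos (ψ t))) (by
    refine continuousOn_const.add ((continuousOn_const.mul (continuousOn_const.sub hqc)).mul
      (continuousOn_const.add ((ContinuousOn.div ?_ ?_ hne).mul
        (Real.continuous_cos.comp_continuousOn hψc))))
    · exact Real.continuous_sqrt.comp_continuousOn (continuousOn_const.sub (hqc.pow 2))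
    · exact Real.continuous_sqrt.comp_continuousOn
        (continuousOn_const.sub ((continuousOn_const.sub hqc).pow 2)))
  set X : ℝ → Space := fun t => polar s ![q t, r - q t] ![ψ t + G t, G t] with hX
  refine ⟨X, (isLeafTrajectory_leafH_iff a d s J X).2 fun t ht =>
    ⟨polar_mem_leaf (abs_slice_lt (hq t ht)) _, ?_⟩, fun t _ => ?_⟩
  swap
  · have := orbit_polar s ![q t, r - q t] ![ψ t + G t, G t] (r := r) (by simp)
    simpa using this
  obtain ⟨hq', hψ'⟩ := h t ht
  rw [deriv_reducedH_angle, sqrt_radicand (hq t ht)] at hq'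
  rw [deriv_reducedH_fst a d (hq t ht), sqrt_radicand (hq t ht)] at hψ'
  have hG' := hG t ht
  have a0 := Real.sqrt_pos.2 (sq_sub_sq_pos (hq t ht).1)
  have a1 := Real.sqrt_pos.2 (sq_sub_sq_pos (hq t ht).2)
  have s0 := Real.sq_sqrt (sq_sub_sq_pos (hq t ht).1).le
  have s1 := Real.sq_sqrt (sq_sub_sq_pos (hq t ht).2).le
  have k0 := hasDerivAt_polar (s := s) (q := fun u => ![q u, r - q u])
    (φ := fun u => ![ψ u + G u, G u]) (k := 0) (hq t ht).1 hq' (hψ'.add hG')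
  have k1 := hasDerivAt_polar (s := s) (q := fun u => ![q u, r - q u])
    (φ := fun u => ![ψ u + G u, G u]) (k := 1) (hq t ht).2 (hq'.const_sub r) hG'
  have hc : (Complex.cos (ψ t)) ^ 2 + Complex.sin (ψ t) ^ 2 = 1 := Complex.cos_sq_add_sin_sq _
  have hE : exp (((ψ t + G t : ℝ) : ℂ) * I)
      = (Complex.cos (ψ t) + Complex.sin (ψ t) * I) * exp ((G t : ℂ) * I) := by
    rw [ofReal_add, add_mul, Complex.exp_add, ← Complex.exp_mul_I]
  have hEE : exp ((G t : ℂ) * I) * conj (exp ((G t : ℂ) * I)) = 1 := by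
    rw [Complex.mul_conj', Complex.norm_exp_ofReal_mul_I]; simp
  simp only [Matrix.cons_val_zero, Matrix.cons_val_one] at k0 k1
  set S0 := Real.sqrt (s 0 ^ 2 - q t ^ 2)
  set S1 := Real.sqrt (s 1 ^ 2 - (r - q t) ^ 2)
  have hw : (X t 0).2 * conj (X t 1).2 = ((1 / 4 * S0 * S1 : ℝ) : ℂ)
      * (Complex.cos (ψ t) + Complex.sin (ψ t) * I) := by
    simp only [hX, polar, Matrix.cons_val_zero, Matrix.cons_val_one, hE, map_mul, conj_ofReal]
    push_cast
    linear_combination ((1 / 4 * S0 * S1 : ℂ)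
      * (Complex.cos (ψ t) + Complex.sin (ψ t) * I)) * hEE
  have hwim : ((X t 0).2 * conj (X t 1).2).im = 1 / 4 * S0 * S1 * Real.sin (ψ t) := by
    rw [hw, Complex.im_ofReal_mul, ← Complex.exp_mul_I, exp_ofReal_mul_I_im]
  have hR : leafR (X t) = r := by simp [leafR, hX, polar]
  have fst0 : ∀ {v : ℝ × ℂ} {k}, HasDerivAt (fun u => X u k) v t →
      HasDerivAt (fun u => (X u k).1) v.1 t := fun h =>
    (ContinuousLinearMap.fst ℝ ℝ ℂ).hasFDerivAt.comp_hasDerivAt t h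
  have snd0 : ∀ {v : ℝ × ℂ} {k}, HasDerivAt (fun u => X u k) v t →
      HasDerivAt (fun u => (X u k).2) v.2 t := fun h =>
    (ContinuousLinearMap.snd ℝ ℝ ℂ).hasFDerivAt.comp_hasDerivAt t h
  have hX0 : X t 0 = (q t, ((1 / 2 * S0 : ℝ) : ℂ)
      * ((Complex.cos (ψ t) + Complex.sin (ψ t) * I) * exp ((G t : ℂ) * I))) := by
    rw [← hE]; rfl
  have hX1 : X t 1 = (r - q t, ((1 / 2 * S1 : ℝ) : ℂ) * exp ((G t : ℂ) * I)) := rfl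
  intro k
  fin_cases k
  · refine ⟨(fst0 k0).congr_deriv ?_, (snd0 k0).congr_deriv ?_⟩
    · have : ((X t 0).2 * conj ((X t 0).2 + (X t 1).2)).im
          = ((X t 0).2 * conj (X t 1).2).im := by
        simp; ring
      change _ = -2 * ((X t 0).2 * conj ((X t 0).2 + (X t 1).2)).im
      rw [this, hwim]
      ring
    · change (_ * exp (((ψ t + G t : ℝ) : ℂ) * I) : ℂ) = I / 2 * ((X t 0).1
        * ((X t 0).2 + (X t 1).2) - ((leafR (X t) + (a 0 - a 1) * d 0 : ℝ) : ℂ) * (X t 0).2)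
      rw [hR, hX0, hX1, hE]
      have A : -q t / (2 * S0) * -(1 / 2 * (S0 * S1) * Real.sin (ψ t))
          = 1 / 4 * q t * S1 * Real.sin (ψ t) := by
        field_simp; ring
      have B : 1 / 2 * S0 * (-(((r - q t) * (s 0 ^ 2 - q t ^ 2) - q t * (s 1 ^ 2 - (r - q t) ^ 2))
          / (2 * (S0 * S1)) * Real.cos (ψ t)
            + (1 / 2 * (r - 2 * q t) + 1 / 2 * (a 0 - a 1) * (d 0 - d 1)))
          + (-(1 / 2 * (r + (a 0 - a 1) * d 1)) + 1 / 2 * (r - q t) * (1 + S0 / S1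
            * Real.cos (ψ t))))
          = 1 / 4 * (q t * (S0 + S1 * Real.cos (ψ t)) - (r + (a 0 - a 1) * d 0) * S0) := by
        rw [← s0, ← s1]
        field_simp
        ring
      rw [A, B]
      push_cast
      linear_combination (I / 4 * q t * S1 * exp ((G t : ℂ) * I)) * hc
        + (1 / 4 * q t * S1 * Complex.cos (ψ t) * Complex.sin (ψ t) * exp ((G t : ℂ) * I)) * I_sq
  · refine ⟨(fst0 k1).congr_deriv ?_, (snd0 k1).congr_deriv ?_⟩
    · have : ((X t 1).2 * conj ((X t 0).2 + (X t 1).2)).im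
          = -((X t 0).2 * conj (X t 1).2).im := by
        simp; ring
      change _ = -2 * ((X t 1).2 * conj ((X t 0).2 + (X t 1).2)).im
      rw [this, hwim]
      ring
    · change (_ * exp ((G t : ℂ) * I) : ℂ) = I / 2 * ((X t 1).1
        * ((X t 0).2 + (X t 1).2) - ((leafR (X t) + (a 0 - a 1) * d 1 : ℝ) : ℂ) * (X t 1).2)
      rw [hR, hX0, hX1]
      have A : -(r - q t) / (2 * S1) * -(-(1 / 2 * (S0 * S1) * Real.sin (ψ t)))
          = -(1 / 4 * (r - q t) * S0 * Real.sin (ψ t)) := by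
        field_simp; ring
      have B : 1 / 2 * S1 * (-(1 / 2 * (r + (a 0 - a 1) * d 1)) + 1 / 2 * (r - q t) * (1 + S0 / S1
            * Real.cos (ψ t)))
          = 1 / 4 * ((r - q t) * (S1 + S0 * Real.cos (ψ t)) - (r + (a 0 - a 1) * d 1) * S1) := by
        field_simp
        ring
      rw [A, B]
      push_cast
      linear_combination (-(1 / 4 * (r - q t) * S0 * Complex.sin (ψ t)
        * exp ((G t : ℂ) * I))) * I_sq

/-! ### The polynomial `w_4` and the integrals of motion -/

theorem w4_eval (a : Fin 2 → ℝ) (d : Fin 3 → ℝ) (s : Fin 2 → ℝ) (r h q : ℝ) :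
    (w4 a d s r h).eval q = (radicand s r).eval q - 4 * (h - (w2 a d s r).eval q) ^ 2 := by
  simp [w4]

/-- Both the product of the two sphere factors and 4(h - w₂)² begin with q⁴, because w₂ begins with
-q²/2. Comparing values on the infinite field ℝ identifies the polynomials. -/
theorem w4_eq_cubic (a : Fin 2 → ℝ) (d : Fin 3 → ℝ) (s : Fin 2 → ℝ) (r h : ℝ) :
    w4 a d s r h = C (2 * (a 0 - a 1) * (d 0 - d 1)) * X ^ 3
      + C (r ^ 2 - s 0 ^ 2 - s 1 ^ 2 - (r + (a 0 - a 1) * (d 0 - d 1)) ^ 2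
          - 4 * (h - (w2 a d s r).eval 0)) * X ^ 2
      + C (2 * r * s 0 ^ 2 + 4 * (r + (a 0 - a 1) * (d 0 - d 1)) * (h - (w2 a d s r).eval 0)) * X
      + C (s 0 ^ 2 * (s 1 ^ 2 - r ^ 2) - 4 * (h - (w2 a d s r).eval 0) ^ 2) := by
  refine Polynomial.funext fun q => ?_
  rw [w4_eval, radicand_eval]
  simp only [w2_eval, eval_add, eval_mul, eval_C, eval_pow, eval_X]
  ring

section Degree

variable {a : Fin 2 → ℝ} {d : Fin 3 → ℝ} (s : Fin 2 → ℝ) (r h : ℝ)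

theorem w4_natDegree (ha : a 0 ≠ a 1) (hd : d 0 ≠ d 1) : (w4 a d s r h).natDegree = 3 := by
  rw [w4_eq_cubic]
  exact natDegree_cubic (mul_ne_zero (mul_ne_zero two_ne_zero (sub_ne_zero.2 ha)) (sub_ne_zero.2 hd))

theorem w4_leadingCoeff (ha : a 0 ≠ a 1) (hd : d 0 ≠ d 1) :
    (w4 a d s r h).leadingCoeff = 2 * (a 0 - a 1) * (d 0 - d 1) := by
  rw [w4_eq_cubic]
  exact leadingCoeff_cubic
    (mul_ne_zero (mul_ne_zero two_ne_zero (sub_ne_zero.2 ha)) (sub_ne_zero.2 hd))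

end Degree

/-- Expanding |η₁ + η₂|² produces the cross term 2 Re w, and the sphere equations express |η₁|² and
|η₂|² through r₁ and r₂. -/
theorem leafH_of_mem_leaf (a : Fin 2 → ℝ) (d : Fin 3 → ℝ) {s : Fin 2 → ℝ} {x : Space}
    (hx : x ∈ leaf s) :
    leafH a d s x = 2 * ((x 0).2 * conj (x 1).2).re + (w2 a d s (leafR x)).eval (x 0).1 := by
  have h0 := hx 0
  have h1 := hx 1
  rw [w2_eval]
  simp only [leafH, leafR, mul_pow, Complex.sq_norm, Complex.normSq_apply, add_re, add_im, mul_re,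
    conj_re, conj_im] at h0 h1 ⊢
  linear_combination 1 / 4 * h0 + 1 / 4 * h1

theorem normSq_mul_conj {s : Fin 2 → ℝ} {x : Space} (hx : x ∈ leaf s) {r : ℝ} (hr : leafR x = r) :
    16 * (((x 0).2 * conj (x 1).2).re ^ 2 + ((x 0).2 * conj (x 1).2).im ^ 2)
      = (radicand s r).eval (x 0).1 := by
  have h0 : s 0 ^ 2 - (x 0).1 ^ 2 = 4 * ‖(x 0).2‖ ^ 2 := by linarith [hx 0]
  have h1 : s 1 ^ 2 - (r - (x 0).1) ^ 2 = 4 * ‖(x 1).2‖ ^ 2 := by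
    have := hx 1
    have h2 : r - (x 0).1 = (x 1).1 := by rw [← hr, leafR]; ring
    rw [h2]; linarith
  rw [radicand_eval, h0, h1]
  simp only [Complex.sq_norm, Complex.normSq_apply, mul_re, mul_im, conj_re, conj_im]
  ring

section Motion

variable {a : Fin 2 → ℝ} {d : Fin 3 → ℝ} {s : Fin 2 → ℝ} {r h : ℝ} {J : Set ℝ} {x : ℝ → Space}

theorem eq_of_hasDerivAt_zero {f : ℝ → ℝ} (hJ : IsOpen J) (hJc : J.OrdConnected)
    (hf : ∀ t ∈ J, HasDerivAt f 0 t) {t u : ℝ} (ht : t ∈ J) (hu : u ∈ J) : f t = f u :=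
  hJ.is_const_of_deriv_eq_zero hJc.isPreconnected
    (fun v hv => (hf v hv).differentiableAt.differentiableWithinAt)
    (fun v hv => (hf v hv).deriv) ht hu

theorem IsLeafTrajectory.leafR_eq (hx : IsLeafTrajectory s (leafH a d s) J x) (hJ : IsOpen J)
    (hJc : J.OrdConnected) {t u : ℝ} (ht : t ∈ J) (hu : u ∈ J) : leafR (x t) = leafR (x u) :=
  eq_of_hasDerivAt_zero (f := fun v => leafR (x v)) hJ hJc (fun v hv =>
    ((hx.hasDerivAt_fst_zero hv).add (hx.hasDerivAt_fst_one hv)).congr_deriv (by ring)) ht hu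

theorem IsLeafTrajectory.hasDerivAt_re (hx : IsLeafTrajectory s (leafH a d s) J x) {t : ℝ}
    (ht : t ∈ J) :
    HasDerivAt (fun u => ((x u 0).2 * conj (x u 1).2).re)
      (-(1 / 2) * ((x t 0).1 - (x t 1).1 - (a 0 - a 1) * (d 0 - d 1))
        * ((x t 0).2 * conj (x t 1).2).im) t := by
  refine (reCLM.hasFDerivAt.comp_hasDerivAt t (hx.hasDerivAt_mul_conj ht)).congr_deriv ?_
  generalize (x t 0).2 * conj (x t 1).2 = w
  generalize (x t 0).1 - (x t 1).1 - (a 0 - a 1) * (d 0 - d 1) = A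
  generalize (x t 0).1 * ‖(x t 1).2‖ ^ 2 - (x t 1).1 * ‖(x t 0).2‖ ^ 2 = B
  simp
  ring

theorem IsLeafTrajectory.hasDerivAt_im (hx : IsLeafTrajectory s (leafH a d s) J x) {t : ℝ}
    (ht : t ∈ J) :
    HasDerivAt (fun u => ((x u 0).2 * conj (x u 1).2).im)
      (1 / 2 * (((x t 0).1 - (x t 1).1 - (a 0 - a 1) * (d 0 - d 1))
        * ((x t 0).2 * conj (x t 1).2).re
        + ((x t 0).1 * ‖(x t 1).2‖ ^ 2 - (x t 1).1 * ‖(x t 0).2‖ ^ 2))) t := by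
  refine (imCLM.hasFDerivAt.comp_hasDerivAt t (hx.hasDerivAt_mul_conj ht)).congr_deriv ?_
  generalize (x t 0).2 * conj (x t 1).2 = w
  generalize (x t 0).1 - (x t 1).1 - (a 0 - a 1) * (d 0 - d 1) = A
  generalize (x t 0).1 * ‖(x t 1).2‖ ^ 2 - (x t 1).1 * ‖(x t 0).2‖ ^ 2 = B
  simp

theorem IsLeafTrajectory.leafH_eq (hx : IsLeafTrajectory s (leafH a d s) J x) (hJ : IsOpen J)
    (hJc : J.OrdConnected) {t u : ℝ} (ht : t ∈ J) (hu : u ∈ J) :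
    leafH a d s (x t) = leafH a d s (x u) := by
  set r := leafR (x t)
  have key : ∀ v ∈ J, leafH a d s (x v)
      = 2 * ((x v 0).2 * conj (x v 1).2).re + (w2 a d s r).eval (x v 0).1 := by
    intro v hv
    rw [leafH_of_mem_leaf a d (hx v hv).1, hx.leafR_eq hJ hJc hv ht]
  rw [key t ht, key u hu]
  refine eq_of_hasDerivAt_zero (f := fun v => 2 * ((x v 0).2 * conj (x v 1).2).re
    + (w2 a d s r).eval (x v 0).1) hJ hJc (fun v hv => ?_) ht hu
  -- The derivative of 2 Re w is a multiple of Im w that cancels w₂'(r₁) ṙ₁, once R = r is used to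
  -- eliminate r.
  refine (((hx.hasDerivAt_re hv).const_mul 2).add (HasDerivAt.comp
    (h₂ := fun y => (w2 a d s r).eval y) v (hasDerivAt_w2 a d)
    (hx.hasDerivAt_fst_zero hv))).congr_deriv ?_
  have : r = (x v 0).1 + (x v 1).1 := hx.leafR_eq hJ hJc ht hv
  rw [this]
  ring

theorem IsLeafTrajectory.four_mul_sq (hx : IsLeafTrajectory s (leafH a d s) J x) {t : ℝ}
    (ht : t ∈ J) (hr : leafR (x t) = r) (hh : leafH a d s (x t) = h) :
    4 * (-2 * ((x t 0).2 * conj (x t 1).2).im) ^ 2 = (w4 a d s r h).eval (x t 0).1 := by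
  rw [w4_eval, ← normSq_mul_conj (hx t ht).1 hr, ← hh, leafH_of_mem_leaf a d (hx t ht).1, hr]
  ring

/-- Differentiating 4 ṙ₁² = w₄(r₁) would give this only where ṙ₁ ≠ 0. Computing the derivative of -2
Im w directly covers the turning points too, which uniqueness later requires. -/
theorem IsLeafTrajectory.hasDerivAt_velocity (hx : IsLeafTrajectory s (leafH a d s) J x) {t : ℝ}
    (ht : t ∈ J) (hr : leafR (x t) = r) (hh : leafH a d s (x t) = h) :
    HasDerivAt (fun u => -2 * ((x u 0).2 * conj (x u 1).2).im)
      ((w4 a d s r h).derivative.eval (x t 0).1 / 8) t := by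
  refine ((hx.hasDerivAt_im ht).const_mul (-2)).congr_deriv ?_
  have e1 : HasDerivAt (fun y => (w4 a d s r h).eval y) _ (x t 0).1 :=
    (w4 a d s r h).hasDerivAt _
  have e2 := (hasDerivAt_radicand (s := s) (r := r) (q := (x t 0).1)).sub
    ((((hasDerivAt_w2 a d (s := s) (r := r) (q := (x t 0).1)).const_sub h).pow 2).const_mul 4)
  have e3 := e1.unique (e2.congr_of_eventuallyEq
    (Filter.Eventually.of_forall fun y => w4_eval a d s r h y))
  rw [e3, ← hh, leafH_of_mem_leaf a d (hx t ht).1, hr]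
  have h0 : s 0 ^ 2 - (x t 0).1 ^ 2 = 4 * ‖(x t 0).2‖ ^ 2 := by linarith [(hx t ht).1 0]
  have h2 : r - (x t 0).1 = (x t 1).1 := by rw [← hr, leafR]; ring
  have h1 : s 1 ^ 2 - (x t 1).1 ^ 2 = 4 * ‖(x t 1).2‖ ^ 2 := by linarith [(hx t ht).1 1]
  have hr' : r = (x t 0).1 + (x t 1).1 := hr.symm
  rw [h2, h0, h1]
  simp only [hr']
  norm_num
  ring

/-! ### The elliptic integral -/

theorem exists_sign_of_ne_zero {v : ℝ → ℝ} {t₀ t₁ : ℝ} (hv : ContinuousOn v (Set.Ioo t₀ t₁))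
    (h0 : ∀ t ∈ Set.Ioo t₀ t₁, v t ≠ 0) :
    ∃ ε : ℝ, (ε = 1 ∨ ε = -1) ∧ ∀ t ∈ Set.Ioo t₀ t₁, 0 < ε * v t := by
  by_cases hp : ∀ t ∈ Set.Ioo t₀ t₁, 0 < v t
  · exact ⟨1, Or.inl rfl, fun t ht => by simpa using hp t ht⟩
  push Not at hp
  obtain ⟨u, hu, hu0⟩ := hp
  refine ⟨-1, Or.inr rfl, fun t ht => ?_⟩
  by_contra hc
  have hc' : 0 ≤ v t := by linarith
  obtain ⟨y, hy, hy0⟩ := isPreconnected_Ioo.intermediate_value hu ht hv ⟨hu0, hc'⟩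
  exact h0 y hy hy0

/-- Under q = f(t) the weight |v| / √p(f) equals the constant 1/2. Integrability up to possible
zeros of p at the endpoints is therefore transported from a bounded time interval. -/
theorem elliptic_integral_of_deriv {f v p : ℝ → ℝ} {t₀ t₁ : ℝ} (ht : t₀ < t₁)
    (hf : ∀ t ∈ Set.Icc t₀ t₁, HasDerivAt f (v t) t) (hv : ContinuousOn v (Set.Icc t₀ t₁))
    (hp : ∀ t ∈ Set.Ioo t₀ t₁, 0 < p (f t))
    (heq : ∀ t ∈ Set.Ioo t₀ t₁, 4 * v t ^ 2 = p (f t)) :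
    ∃ ε : ℝ, (ε = 1 ∨ ε = -1) ∧ (∀ t ∈ Set.Ioo t₀ t₁, 0 < ε * v t) ∧
      IntervalIntegrable (fun q => 1 / Real.sqrt (p q)) MeasureTheory.volume (f t₀) (f t₁) ∧
      t₁ - t₀ = ε * (2 * ∫ q in (f t₀)..(f t₁), 1 / Real.sqrt (p q)) := by
  have hsub : Set.Ioo t₀ t₁ ⊆ Set.Icc t₀ t₁ := Set.Ioo_subset_Icc_self
  have hv0 : ∀ t ∈ Set.Ioo t₀ t₁, v t ≠ 0 := by
    intro t h hvt
    have := heq t h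
    rw [hvt] at this
    linarith [hp t h]
  have hfc : ContinuousOn f (Set.Icc t₀ t₁) := fun t h => (hf t h).continuousAt.continuousWithinAt
  obtain ⟨ε, hε, hpos⟩ := exists_sign_of_ne_zero (hv.mono hsub) hv0
  have hconst : ∀ t ∈ Set.Ioo t₀ t₁, |v t| • (1 / Real.sqrt (p (f t))) = 1 / 2 := by
    intro t h
    have h1 : p (f t) = (2 * |v t|) ^ 2 := by rw [mul_pow, sq_abs, ← heq t h]; ring
    have h2 : 0 < |v t| := abs_pos.2 (hv0 t h)
    rw [h1, Real.sqrt_sq (by positivity), smul_eq_mul]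
    field_simp
  have hder : ∀ t ∈ Set.Ioo t₀ t₁, HasDerivWithinAt f (v t) (Set.Ioo t₀ t₁) t :=
    fun t h => (hf t (hsub h)).hasDerivWithinAt
  -- The change of variables is made on the open interval, so nothing is asked of 1/√p at the
  -- endpoints; it serves both the increasing and the decreasing case.
  have main : ∀ S : Set ℝ, Set.InjOn f (Set.Ioo t₀ t₁) → f '' Set.Ioo t₀ t₁ = S →
      MeasureTheory.IntegrableOn (fun q => 1 / Real.sqrt (p q)) S ∧
        ∫ q in S, 1 / Real.sqrt (p q) = (t₁ - t₀) / 2 := by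
    rintro S hinj rfl
    constructor
    · rw [MeasureTheory.integrableOn_image_iff_integrableOn_abs_deriv_smul measurableSet_Ioo hder
        hinj, MeasureTheory.integrableOn_congr_fun hconst measurableSet_Ioo]
      simp
    · rw [MeasureTheory.integral_image_eq_integral_abs_deriv_smul measurableSet_Ioo hder hinj,
        MeasureTheory.setIntegral_congr_fun measurableSet_Ioo hconst]
      simp [ht.le]
      ring
  have hint : interior (Set.Icc t₀ t₁) = Set.Ioo t₀ t₁ := interior_Icc
  have ml : t₀ ∈ Set.Icc t₀ t₁ := Set.left_mem_Icc.2 ht.le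
  have mr : t₁ ∈ Set.Icc t₀ t₁ := Set.right_mem_Icc.2 ht.le
  refine ⟨ε, hε, hpos, ?_⟩
  rcases hε with rfl | rfl
  · have hm : StrictMonoOn f (Set.Icc t₀ t₁) := by
      refine strictMonoOn_of_deriv_pos (convex_Icc _ _) hfc fun t h => ?_
      rw [hint] at h
      rw [(hf t (hsub h)).deriv]
      simpa using hpos t h
    have hle : f t₀ ≤ f t₁ := (hm ml mr ht).le
    obtain ⟨h1, h2⟩ := main (Set.Ioo (f t₀) (f t₁)) (hm.injOn.mono hsub) (by
      refine Set.Subset.antisymm ?_ (intermediate_value_Ioo ht.le hfc)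
      rintro _ ⟨t, h, rfl⟩
      exact ⟨hm ml (hsub h) h.1, hm (hsub h) mr h.2⟩)
    refine ⟨(intervalIntegrable_iff_integrableOn_Ioo_of_le hle).2 h1, ?_⟩
    rw [intervalIntegral.integral_of_le hle, MeasureTheory.integral_Ioc_eq_integral_Ioo, h2]
    ring
  · have hm : StrictAntiOn f (Set.Icc t₀ t₁) := by
      refine strictAntiOn_of_deriv_neg (convex_Icc _ _) hfc fun t h => ?_
      rw [hint] at h
      rw [(hf t (hsub h)).deriv]
      linarith [hpos t h]
    have hle : f t₁ ≤ f t₀ := (hm ml mr ht).le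
    obtain ⟨h1, h2⟩ := main (Set.Ioo (f t₁) (f t₀)) (hm.injOn.mono hsub) (by
      refine Set.Subset.antisymm ?_ (intermediate_value_Ioo' ht.le hfc)
      rintro _ ⟨t, h, rfl⟩
      exact ⟨hm (hsub h) mr h.2, hm ml (hsub h) h.1⟩)
    refine ⟨((intervalIntegrable_iff_integrableOn_Ioo_of_le hle).2 h1).symm, ?_⟩
    rw [intervalIntegral.integral_symm, intervalIntegral.integral_of_le hle,
      MeasureTheory.integral_Ioc_eq_integral_Ioo, h2]
    ring

/-! ### The angle -/

/-- Reduce ψ to (-π, π]; a nonnegative sine then places it in [0, π], where arccos inverts cos. -/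
theorem exists_eq_arccos_cos_add {ψ : ℝ} (h : 0 ≤ Real.sin ψ) :
    ∃ n : ℤ, ψ = Real.arccos (Real.cos ψ) + 2 * Real.pi * n := by
  set χ := toIocMod Real.two_pi_pos (-Real.pi) ψ with hχ
  set n := toIocDiv Real.two_pi_pos (-Real.pi) ψ
  have hmem := toIocMod_mem_Ioc Real.two_pi_pos (-Real.pi) ψ
  have hψ : ψ = χ + n * (2 * Real.pi) := by
    have := toIocMod_add_toIocDiv_zsmul Real.two_pi_pos (-Real.pi) ψ
    rw [zsmul_eq_mul] at this
    exact this.symm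
  rw [← hχ] at hmem
  have hcos : Real.cos ψ = Real.cos χ := by rw [hψ, Real.cos_add_int_mul_two_pi]
  have hsin : Real.sin ψ = Real.sin χ := by rw [hψ, Real.sin_add_int_mul_two_pi]
  have h0 : 0 ≤ χ := by
    by_contra hc
    push Not at hc
    linarith [Real.sin_neg_of_neg_of_neg_pi_lt hc hmem.1]
  refine ⟨n, ?_⟩
  rw [hcos, Real.arccos_cos h0 (by linarith [hmem.2])]
  linarith

theorem IsLeafTrajectory.angle_eq (hx : IsLeafTrajectory s (leafH a d s) J x) {t : ℝ}
    (ht : t ∈ J) (hr : leafR (x t) = r) (hh : leafH a d s (x t) = h)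
    (hq : (x t 0).1 ∈ reducedRange s r) {ψ : ℝ}
    (hψ : orbit (x t) = reducedChart s r (x t 0).1 ψ) {c : ℝ}
    (hc : c = Real.arccos (2 * (h - (w2 a d s r).eval (x t 0).1)
      / Real.sqrt ((radicand s r).eval (x t 0).1))) :
    (0 ≤ ψ → ψ ≤ Real.pi → ψ = c) ∧
    (deriv (fun u => (x u 0).1) t ≤ 0 → ∃ n : ℤ, ψ = c + 2 * Real.pi * n) ∧
    (0 ≤ deriv (fun u => (x u 0).1) t → ∃ n : ℤ, ψ = -c + 2 * Real.pi * n) := by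
  have hS := sqrt_radicand_pos hq
  have hw := (of_orbit_eq_reducedChart hψ).2.2.trans (slice_mul_conj hq ψ)
  have hcos : c = Real.arccos (Real.cos ψ) := by
    rw [hc, ← hh, leafH_of_mem_leaf a d (hx t ht).1, hr, hw, Complex.re_ofReal_mul,
      exp_ofReal_mul_I_re]
    congr 1
    field_simp
    ring
  -- The velocity has the sign of -sin ψ, so it selects between the two solutions ±c of the cosine
  -- equation.
  have hder : deriv (fun u => (x u 0).1) t
      = -(1 / 2 * Real.sqrt ((radicand s r).eval (x t 0).1) * Real.sin ψ) := by
    rw [(hx.hasDerivAt_fst_zero ht).deriv, hw, Complex.im_ofReal_mul, exp_ofReal_mul_I_im]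
    ring
  rw [hder, hcos]
  refine ⟨fun h0 h1 => (Real.arccos_cos h0 h1).symm, fun h0 => exists_eq_arccos_cos_add ?_,
    fun h0 => ?_⟩
  · by_contra hneg
    push Not at hneg
    nlinarith [mul_pos hS (neg_pos.2 hneg)]
  · obtain ⟨n, hn⟩ := exists_eq_arccos_cos_add (ψ := -ψ) (by
      rw [Real.sin_neg]
      by_contra hneg
      push Not at hneg
      nlinarith [mul_pos hS (neg_lt_zero.1 hneg)])
    refine ⟨-n, ?_⟩
    rw [Real.cos_neg] at hn
    push_cast
    linarith

end Motion

/-! ### Jacobi elliptic functions of a real variable, with parameter `m = k²` -/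

theorem one_sub_mul_sin_sq_pos {m : ℝ} (h1 : m < 1) (φ : ℝ) : 0 < 1 - m * Real.sin φ ^ 2 := by
  have h2 := Real.sin_sq_le_one φ
  have h3 := sq_nonneg (Real.sin φ)
  rcases le_total m 0 with h | h <;> nlinarith

/-- The incomplete elliptic integral of the first kind. -/
noncomputable def ellipticF (m φ : ℝ) : ℝ :=
  ∫ θ in (0 : ℝ)..φ, 1 / Real.sqrt (1 - m * Real.sin θ ^ 2)

/-- The Jacobi amplitude. -/
noncomputable def jacobiAm (m : ℝ) : ℝ → ℝ := Function.invFun (ellipticF m)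

noncomputable def jacobiSn (m u : ℝ) : ℝ := Real.sin (jacobiAm m u)

noncomputable def jacobiCn (m u : ℝ) : ℝ := Real.cos (jacobiAm m u)

noncomputable def jacobiDn (m u : ℝ) : ℝ := Real.sqrt (1 - m * jacobiSn m u ^ 2)

section Real

variable {m : ℝ}

theorem hasDerivAt_ellipticF (h1 : m < 1) (φ : ℝ) :
    HasDerivAt (ellipticF m) (1 / Real.sqrt (1 - m * Real.sin φ ^ 2)) φ := by
  have hc : Continuous fun θ => 1 / Real.sqrt (1 - m * Real.sin θ ^ 2) := by
    refine continuous_const.div (by fun_prop) fun θ => ?_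
    exact (Real.sqrt_pos.2 (one_sub_mul_sin_sq_pos h1 θ)).ne'
  exact intervalIntegral.integral_hasDerivAt_right (hc.intervalIntegrable _ _)
    (hc.stronglyMeasurableAtFilter _ _) hc.continuousAt

theorem ellipticF_strictMono (h1 : m < 1) : StrictMono (ellipticF m) := by
  refine strictMono_of_deriv_pos fun φ => ?_
  rw [(hasDerivAt_ellipticF h1 φ).deriv]
  have := Real.sqrt_pos.2 (one_sub_mul_sin_sq_pos h1 φ)
  positivity

theorem ellipticF_zero (m : ℝ) : ellipticF m 0 = 0 := intervalIntegral.integral_same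

theorem ellipticF_continuous (h1 : m < 1) : Continuous (ellipticF m) :=
  continuous_iff_continuousAt.2 fun φ => (hasDerivAt_ellipticF h1 φ).continuousAt

/-- For 0 ≤ m < 1 the integrand is at least 1, so F(φ) - φ is monotone and F is unbounded in both
directions. This makes the `Function.invFun` in `jacobiAm` a genuine inverse. -/
theorem ellipticF_surjective (h0 : 0 ≤ m) (h1 : m < 1) : Function.Surjective (ellipticF m) := by
  have hmono : Monotone fun φ => ellipticF m φ - φ := by
    refine monotone_of_deriv_nonneg
      (fun φ => ((hasDerivAt_ellipticF h1 φ).sub (hasDerivAt_id φ)).differentiableAt) fun φ => ?_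
    have hd : deriv (fun φ => ellipticF m φ - φ) φ = 1 / Real.sqrt (1 - m * Real.sin φ ^ 2) - 1 :=
      ((hasDerivAt_ellipticF h1 φ).sub (hasDerivAt_id φ)).deriv
    rw [hd, sub_nonneg, le_div_iff₀ (Real.sqrt_pos.2 (one_sub_mul_sin_sq_pos h1 φ)), one_mul]
    refine Real.sqrt_le_one.2 ?_
    nlinarith [sq_nonneg (Real.sin φ)]
  have hz : ellipticF m 0 - 0 = 0 := by rw [ellipticF_zero, sub_zero]
  refine (ellipticF_continuous h1).surjective ?_ ?_
  · refine Filter.tendsto_atTop_mono' _ ?_ Filter.tendsto_id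
    filter_upwards [Filter.eventually_ge_atTop 0] with φ hφ
    have : ellipticF m 0 - 0 ≤ ellipticF m φ - φ := hmono hφ
    simp only [id]
    linarith
  · refine Filter.tendsto_atBot_mono' _ ?_ Filter.tendsto_id
    filter_upwards [Filter.eventually_le_atBot 0] with φ hφ
    have : ellipticF m φ - φ ≤ ellipticF m 0 - 0 := hmono hφ
    simp only [id]
    linarith

theorem ellipticF_jacobiAm (h0 : 0 ≤ m) (h1 : m < 1) (u : ℝ) : ellipticF m (jacobiAm m u) = u :=
  Function.rightInverse_invFun (ellipticF_surjective h0 h1) u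

theorem jacobiAm_ellipticF (h1 : m < 1) (φ : ℝ) : jacobiAm m (ellipticF m φ) = φ :=
  Function.leftInverse_invFun (ellipticF_strictMono h1).injective φ

theorem jacobiAm_continuous (h0 : 0 ≤ m) (h1 : m < 1) : Continuous (jacobiAm m) := by
  have hmono : Monotone (jacobiAm m) := fun u v huv => by
    rw [← (ellipticF_strictMono h1).le_iff_le, ellipticF_jacobiAm h0 h1, ellipticF_jacobiAm h0 h1]
    exact huv
  exact hmono.continuous_of_surjective fun φ => ⟨_, jacobiAm_ellipticF h1 φ⟩

theorem hasDerivAt_jacobiAm (h0 : 0 ≤ m) (h1 : m < 1) (u : ℝ) :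
    HasDerivAt (jacobiAm m) (jacobiDn m u) u := by
  have hpos := Real.sqrt_pos.2 (one_sub_mul_sin_sq_pos h1 (jacobiAm m u))
  have := HasDerivAt.of_local_left_inverse (jacobiAm_continuous h0 h1).continuousAt
    (hasDerivAt_ellipticF h1 (jacobiAm m u)) (by positivity)
    (Filter.Eventually.of_forall (ellipticF_jacobiAm h0 h1))
  exact this.congr_deriv (by rw [one_div, inv_inv]; rfl)

theorem jacobiSn_sq_add (m u : ℝ) : jacobiSn m u ^ 2 + jacobiCn m u ^ 2 = 1 :=
  Real.sin_sq_add_cos_sq _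

theorem jacobiDn_pos (h1 : m < 1) (u : ℝ) : 0 < jacobiDn m u :=
  Real.sqrt_pos.2 (one_sub_mul_sin_sq_pos h1 _)

theorem jacobiDn_sq (h1 : m < 1) (u : ℝ) : jacobiDn m u ^ 2 = 1 - m * jacobiSn m u ^ 2 :=
  Real.sq_sqrt (one_sub_mul_sin_sq_pos h1 _).le

theorem hasDerivAt_jacobiSn (h0 : 0 ≤ m) (h1 : m < 1) (u : ℝ) :
    HasDerivAt (jacobiSn m) (jacobiCn m u * jacobiDn m u) u :=
  (hasDerivAt_jacobiAm h0 h1 u).sin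

theorem hasDerivAt_jacobiCn (h0 : 0 ≤ m) (h1 : m < 1) (u : ℝ) :
    HasDerivAt (jacobiCn m) (-jacobiSn m u * jacobiDn m u) u :=
  (hasDerivAt_jacobiAm h0 h1 u).cos

theorem hasDerivAt_jacobiDn (h0 : 0 ≤ m) (h1 : m < 1) (u : ℝ) :
    HasDerivAt (jacobiDn m) (-m * jacobiSn m u * jacobiCn m u) u := by
  have hp := one_sub_mul_sin_sq_pos h1 (jacobiAm m u)
  have h := ((((hasDerivAt_jacobiSn h0 h1 u).pow 2).const_mul m).const_sub 1).sqrt hp.ne'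
  refine h.congr_deriv ?_
  have := (jacobiDn_pos h1 u).ne'
  change _ / (2 * jacobiDn m u) = _
  field_simp
  ring

/-- Half of the real period of `sn`. -/
noncomputable def jacobiHalfPeriod (m : ℝ) : ℝ := ellipticF m Real.pi

theorem jacobiHalfPeriod_pos (h1 : m < 1) : 0 < jacobiHalfPeriod m := by
  rw [← ellipticF_zero m]
  exact ellipticF_strictMono h1 Real.pi_pos

/-- The integrand depends on sin² and so has period π. Consequently F(π) = 2K is an antiperiod of sn
and a period of sn². -/
theorem ellipticF_add_pi (h1 : m < 1) (φ : ℝ) :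
    ellipticF m (φ + Real.pi) = ellipticF m φ + jacobiHalfPeriod m := by
  have hd : ∀ φ, HasDerivAt (fun φ => ellipticF m (φ + Real.pi) - ellipticF m φ) 0 φ := by
    intro φ
    refine (((hasDerivAt_ellipticF h1 (φ + Real.pi)).comp_add_const φ Real.pi).sub
      (hasDerivAt_ellipticF h1 φ)).congr_deriv ?_
    rw [Real.sin_add_pi, neg_sq, sub_self]
  have := is_const_of_deriv_eq_zero (fun u => (hd u).differentiableAt) (fun u => (hd u).deriv) φ 0
  simp only [zero_add, ellipticF_zero, sub_zero] at this
  rw [jacobiHalfPeriod]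
  linarith

theorem jacobiAm_add (h0 : 0 ≤ m) (h1 : m < 1) (u : ℝ) :
    jacobiAm m (u + jacobiHalfPeriod m) = jacobiAm m u + Real.pi := by
  refine (ellipticF_strictMono h1).injective ?_
  rw [ellipticF_jacobiAm h0 h1, ellipticF_add_pi h1, ellipticF_jacobiAm h0 h1]

theorem jacobiSn_add (h0 : 0 ≤ m) (h1 : m < 1) (u : ℝ) :
    jacobiSn m (u + jacobiHalfPeriod m) = -jacobiSn m u := by
  rw [jacobiSn, jacobiAm_add h0 h1, Real.sin_add_pi, jacobiSn]

theorem jacobiCn_add (h0 : 0 ≤ m) (h1 : m < 1) (u : ℝ) :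
    jacobiCn m (u + jacobiHalfPeriod m) = -jacobiCn m u := by
  rw [jacobiCn, jacobiAm_add h0 h1, Real.cos_add_pi, jacobiCn]

theorem jacobiDn_add (h0 : 0 ≤ m) (h1 : m < 1) (u : ℝ) :
    jacobiDn m (u + jacobiHalfPeriod m) = jacobiDn m u := by
  rw [jacobiDn, jacobiSn_add h0 h1, neg_sq, jacobiDn]

theorem jacobiAm_zero (h1 : m < 1) : jacobiAm m 0 = 0 := by
  have := jacobiAm_ellipticF h1 0
  rwa [ellipticF_zero] at this

theorem jacobiSn_zero (h1 : m < 1) : jacobiSn m 0 = 0 := by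
  rw [jacobiSn, jacobiAm_zero h1, Real.sin_zero]

theorem jacobiCn_zero (h1 : m < 1) : jacobiCn m 0 = 1 := by
  rw [jacobiCn, jacobiAm_zero h1, Real.cos_zero]

theorem jacobiDn_zero (h1 : m < 1) : jacobiDn m 0 = 1 := by
  rw [jacobiDn, jacobiSn_zero h1]
  simp

end Real

/-! ### The Jacobi function `sn` of a complex variable -/

/-- The denominator of `sn (u + iv)`. -/
noncomputable def snDen (m u v : ℝ) : ℝ :=
  jacobiCn (1 - m) v ^ 2 + m * jacobiSn m u ^ 2 * jacobiSn (1 - m) v ^ 2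

/-- The denominator of `1 / sn (u + iv)`. -/
noncomputable def nsDen (m u v : ℝ) : ℝ :=
  jacobiSn m u ^ 2 * jacobiCn (1 - m) v ^ 2 + jacobiSn (1 - m) v ^ 2

noncomputable def snRe (m u v : ℝ) : ℝ := jacobiSn m u * jacobiDn (1 - m) v

noncomputable def snIm (m u v : ℝ) : ℝ :=
  jacobiCn m u * jacobiDn m u * (jacobiSn (1 - m) v * jacobiCn (1 - m) v)

/-- `sn (u + iv)`, by the addition theorem and the imaginary transformation. -/
noncomputable def complexSn (m : ℝ) (z : ℂ) : ℂ :=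
  ((snRe m z.re z.im : ℂ) + I * snIm m z.re z.im) / snDen m z.re z.im

/-- `1 / sn (u + iv)`. -/
noncomputable def complexNs (m : ℝ) (z : ℂ) : ℂ :=
  ((snRe m z.re z.im : ℂ) + I * (-snIm m z.re z.im : ℝ)) / nsDen m z.re z.im

/-- Complex differentiability needs a real differential that is complex linear; the values on 1 and
i are the two partial derivatives. -/
theorem differentiableAt_of_cauchyRiemann {f : ℂ → ℂ} {z A B : ℂ} (hd : DifferentiableAt ℝ f z)
    (hx : HasDerivAt (fun u : ℝ => f (u + z.im * I)) A z.re)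
    (hy : HasDerivAt (fun v : ℝ => f (z.re + v * I)) B z.im) (h : B = I * A) :
    DifferentiableAt ℂ f z := by
  rw [differentiableAt_complex_iff_differentiableAt_real]
  refine ⟨hd, ?_⟩
  have e : (z.re : ℂ) + z.im * I = z := Complex.re_add_im z
  have h1 : HasDerivAt (fun u : ℝ => (u : ℂ) + z.im * I) 1 z.re := by
    simpa using ((hasDerivAt_id z.re).ofReal_comp).add_const ((z.im : ℂ) * I)
  have h2 : HasDerivAt (fun v : ℝ => (z.re : ℂ) + v * I) I z.im := by
    simpa using (((hasDerivAt_id z.im).ofReal_comp).mul_const I).const_add (z.re : ℂ)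
  have hf : HasFDerivAt f (fderiv ℝ f z) ((z.re : ℂ) + z.im * I) := by
    rw [e]; exact hd.hasFDerivAt
  have e1 : fderiv ℝ f z 1 = A := (hf.comp_hasDerivAt z.re h1).unique hx
  have e2 : fderiv ℝ f z I = B := (hf.comp_hasDerivAt z.im h2).unique hy
  rw [e1, e2, h, smul_eq_mul]

section Complex

variable {m : ℝ}

theorem differentiable_comp_re {f : ℝ → ℝ} (hf : Differentiable ℝ f) :
    Differentiable ℝ fun z : ℂ => f z.re :=
  hf.comp reCLM.differentiable

theorem differentiable_comp_im {f : ℝ → ℝ} (hf : Differentiable ℝ f) :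
    Differentiable ℝ fun z : ℂ => f z.im :=
  hf.comp imCLM.differentiable

theorem jacobi_differentiable (h0 : 0 ≤ m) (h1 : m < 1) :
    Differentiable ℝ (jacobiSn m) ∧ Differentiable ℝ (jacobiCn m) ∧ Differentiable ℝ (jacobiDn m) :=
  ⟨fun u => (hasDerivAt_jacobiSn h0 h1 u).differentiableAt,
    fun u => (hasDerivAt_jacobiCn h0 h1 u).differentiableAt,
    fun u => (hasDerivAt_jacobiDn h0 h1 u).differentiableAt⟩

theorem sn_parts_differentiable (h0 : 0 < m) (h1 : m < 1) :
    Differentiable ℝ (fun z : ℂ => snRe m z.re z.im) ∧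
    Differentiable ℝ (fun z : ℂ => snIm m z.re z.im) ∧
    Differentiable ℝ (fun z : ℂ => snDen m z.re z.im) ∧
    Differentiable ℝ (fun z : ℂ => nsDen m z.re z.im) := by
  obtain ⟨a1, a2, a3⟩ := jacobi_differentiable h0.le h1
  obtain ⟨b1, b2, b3⟩ := jacobi_differentiable (m := 1 - m) (by linarith) (by linarith)
  have a1 := differentiable_comp_re a1
  have a2 := differentiable_comp_re a2
  have a3 := differentiable_comp_re a3
  have b1 := differentiable_comp_im b1
  have b2 := differentiable_comp_im b2
  have b3 := differentiable_comp_im b3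
  refine ⟨a1.mul b3, (a2.mul a3).mul (b1.mul b2), ?_, ?_⟩
  · exact (b2.pow 2).add (((a1.pow 2).const_mul m).mul (b1.pow 2))
  · exact ((a1.pow 2).mul (b2.pow 2)).add (b1.pow 2)

theorem ofReal_differentiable {f : ℂ → ℝ} (hf : Differentiable ℝ f) :
    Differentiable ℝ fun z => (f z : ℂ) :=
  ofRealCLM.differentiable.comp hf

theorem hasDerivAt_quotient {p q D : ℝ → ℝ} {p' q' D' t : ℝ} (hp : HasDerivAt p p' t)
    (hq : HasDerivAt q q' t) (hD : HasDerivAt D D' t) (h0 : D t ≠ 0) :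
    HasDerivAt (fun u => ((p u : ℂ) + I * q u) / D u)
      (((p' * D t - p t * D' : ℝ) + I * (q' * D t - q t * D' : ℝ)) / D t ^ 2) t := by
  have hc : (D t : ℂ) ≠ 0 := by exact_mod_cast h0
  refine ((hp.ofReal_comp.add (hq.ofReal_comp.const_mul I)).div hD.ofReal_comp hc).congr_deriv ?_
  simp only [Pi.add_apply]
  push_cast
  congr 1
  ring

/-- The conditions `e1` and `e2` are the Cauchy–Riemann equations for (p + iq)/D with the common
factor D⁻² cleared. -/
theorem differentiableAt_quotient {p q D : ℝ → ℝ → ℝ} {z : ℂ} {px py qx qy Dx Dy : ℝ}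
    (dp : Differentiable ℝ fun z : ℂ => p z.re z.im)
    (dq : Differentiable ℝ fun z : ℂ => q z.re z.im)
    (dD : Differentiable ℝ fun z : ℂ => D z.re z.im) (h0 : D z.re z.im ≠ 0)
    (hpx : HasDerivAt (fun u => p u z.im) px z.re) (hpy : HasDerivAt (fun v => p z.re v) py z.im)
    (hqx : HasDerivAt (fun u => q u z.im) qx z.re) (hqy : HasDerivAt (fun v => q z.re v) qy z.im)
    (hDx : HasDerivAt (fun u => D u z.im) Dx z.re) (hDy : HasDerivAt (fun v => D z.re v) Dy z.im)
    (e1 : py * D z.re z.im - p z.re z.im * Dy = -(qx * D z.re z.im - q z.re z.im * Dx))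
    (e2 : qy * D z.re z.im - q z.re z.im * Dy = px * D z.re z.im - p z.re z.im * Dx) :
    DifferentiableAt ℂ (fun z : ℂ => ((p z.re z.im : ℂ) + I * q z.re z.im) / D z.re z.im) z := by
  have hc : (D z.re z.im : ℂ) ≠ 0 := by exact_mod_cast h0
  have hx := hasDerivAt_quotient hpx hqx hDx h0
  have hy := hasDerivAt_quotient hpy hqy hDy h0
  refine differentiableAt_of_cauchyRiemann (f := fun z : ℂ =>
    ((p z.re z.im : ℂ) + I * q z.re z.im) / D z.re z.im) ?_
    (hx.congr_of_eventuallyEq (Filter.Eventually.of_forall fun u => by simp))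
    (hy.congr_of_eventuallyEq (Filter.Eventually.of_forall fun v => by simp)) ?_
  · exact ((ofReal_differentiable dp).differentiableAt.add
      ((ofReal_differentiable dq).differentiableAt.const_mul I)).mul
        ((ofReal_differentiable dD).differentiableAt.inv hc)
  · rw [e1, e2]
    push_cast
    linear_combination (-(qx * D z.re z.im - q z.re z.im * Dx : ℂ) / D z.re z.im ^ 2) * I_sq

theorem jacobi_relations (h0 : 0 < m) (h1 : m < 1) (u v : ℝ) :
    jacobiCn m u ^ 2 = 1 - jacobiSn m u ^ 2 ∧ jacobiDn m u ^ 2 = 1 - m * jacobiSn m u ^ 2 ∧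
    jacobiCn (1 - m) v ^ 2 = 1 - jacobiSn (1 - m) v ^ 2 ∧
    jacobiDn (1 - m) v ^ 2 = 1 - (1 - m) * jacobiSn (1 - m) v ^ 2 :=
  ⟨by linarith [jacobiSn_sq_add m u], jacobiDn_sq h1 u, by linarith [jacobiSn_sq_add (1 - m) v],
    jacobiDn_sq (by linarith) v⟩

theorem complexSn_differentiableAt (h0 : 0 < m) (h1 : m < 1) {z : ℂ}
    (hz : snDen m z.re z.im ≠ 0) : DifferentiableAt ℂ (complexSn m) z := by
  obtain ⟨d1, d2, d3, -⟩ := sn_parts_differentiable h0 h1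
  have h0' : 0 ≤ 1 - m := by linarith
  have h1' : 1 - m < 1 := by linarith
  have hS := hasDerivAt_jacobiSn h0.le h1 z.re
  have hC := hasDerivAt_jacobiCn h0.le h1 z.re
  have hD := hasDerivAt_jacobiDn h0.le h1 z.re
  have hS' := hasDerivAt_jacobiSn h0' h1' z.im
  have hC' := hasDerivAt_jacobiCn h0' h1' z.im
  have hD' := hasDerivAt_jacobiDn h0' h1' z.im
  obtain ⟨r1, r2, r3, r4⟩ := jacobi_relations h0 h1 z.re z.im
  refine differentiableAt_quotient d1 d2 d3 hz (hS.mul_const _) (hD'.const_mul _)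
    ((hC.mul hD).mul_const _) ((hS'.mul hC').const_mul _)
    ((((hS.pow 2).const_mul m).mul_const _).const_add _)
    ((hC'.pow 2).add ((hS'.pow 2).const_mul _)) ?_ ?_
  -- What remains are polynomial identities modulo the relations `r1`–`r4` among sn, cn and dn for
  -- the parameters m and 1 - m.
  all_goals
    simp only [snRe, snIm, snDen]
    generalize jacobiSn m z.re = s at *
    generalize jacobiCn m z.re = c at *
    generalize jacobiDn m z.re = d at *
    generalize jacobiSn (1 - m) z.im = s' at *
    generalize jacobiCn (1 - m) z.im = c' at *
    generalize jacobiDn (1 - m) z.im = d' at *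
    clear * - r1 r2 r3 r4
    push_cast
    grind

theorem complexNs_differentiableAt (h0 : 0 < m) (h1 : m < 1) {z : ℂ}
    (hz : nsDen m z.re z.im ≠ 0) : DifferentiableAt ℂ (complexNs m) z := by
  obtain ⟨d1, d2, -, d3⟩ := sn_parts_differentiable h0 h1
  have h0' : 0 ≤ 1 - m := by linarith
  have h1' : 1 - m < 1 := by linarith
  have hS := hasDerivAt_jacobiSn h0.le h1 z.re
  have hC := hasDerivAt_jacobiCn h0.le h1 z.re
  have hD := hasDerivAt_jacobiDn h0.le h1 z.re
  have hS' := hasDerivAt_jacobiSn h0' h1' z.im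
  have hC' := hasDerivAt_jacobiCn h0' h1' z.im
  have hD' := hasDerivAt_jacobiDn h0' h1' z.im
  obtain ⟨r1, r2, r3, r4⟩ := jacobi_relations h0 h1 z.re z.im
  refine differentiableAt_quotient (q := fun u v => -snIm m u v) d1 d2.neg d3 hz
    (hS.mul_const _) (hD'.const_mul _)
    ((hC.mul hD).mul_const _).neg ((hS'.mul hC').const_mul _).neg
    (((hS.pow 2).mul_const _).add_const _)
    (((hC'.pow 2).const_mul _).add (hS'.pow 2)) ?_ ?_
  all_goals
    simp only [snRe, snIm, nsDen]
    generalize jacobiSn m z.re = s at *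
    generalize jacobiCn m z.re = c at *
    generalize jacobiDn m z.re = d at *
    generalize jacobiSn (1 - m) z.im = s' at *
    generalize jacobiCn (1 - m) z.im = c' at *
    generalize jacobiDn (1 - m) z.im = d' at *
    clear * - r1 r2 r3 r4
    push_cast
    grind

/-- Both summands are nonnegative, so both vanish; cn = 0 forces sn² = 1 in the second variable,
leaving sn = 0 in the first. -/
theorem snDen_eq_zero (h0 : 0 < m) {u v : ℝ} (h : snDen m u v = 0) :
    jacobiSn m u = 0 ∧ jacobiCn (1 - m) v = 0 := by
  have hrel := jacobiSn_sq_add (1 - m) v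
  rw [snDen] at h
  have h1 : 0 ≤ m * jacobiSn m u ^ 2 * jacobiSn (1 - m) v ^ 2 := by positivity
  have h2 : jacobiCn (1 - m) v ^ 2 = 0 := by nlinarith [sq_nonneg (jacobiCn (1 - m) v)]
  have h3 : m * jacobiSn m u ^ 2 = 0 := by
    have : jacobiSn (1 - m) v ^ 2 = 1 := by linarith
    rw [this] at h
    linarith
  exact ⟨by simpa [h0.ne'] using h3, by simpa using h2⟩

theorem complexSn_eq_inv (h0 : 0 < m) (h1 : m < 1) {z : ℂ} (hz : nsDen m z.re z.im ≠ 0) :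
    complexSn m z = (complexNs m z)⁻¹ := by
  by_cases hD : snDen m z.re z.im = 0
  -- At a pole of sn both sides are 0: division by zero gives 0 on the left, and the numerator of ns
  -- vanishes on the right.
  · obtain ⟨e1, e2⟩ := snDen_eq_zero h0 hD
    simp [complexSn, complexNs, snRe, snIm, e1, e2]
  refine eq_inv_of_mul_eq_one_left ?_
  obtain ⟨r1, r2, r3, r4⟩ := jacobi_relations h0 h1 z.re z.im
  have hD' : (snDen m z.re z.im : ℂ) ≠ 0 := by exact_mod_cast hD
  have hz' : (nsDen m z.re z.im : ℂ) ≠ 0 := by exact_mod_cast hz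
  have key : snRe m z.re z.im ^ 2 + snIm m z.re z.im ^ 2
      = snDen m z.re z.im * nsDen m z.re z.im := by
    simp only [snRe, snIm, snDen, nsDen]
    generalize jacobiSn m z.re = s at *
    generalize jacobiCn m z.re = c at *
    generalize jacobiDn m z.re = d at *
    generalize jacobiSn (1 - m) z.im = s' at *
    generalize jacobiCn (1 - m) z.im = c' at *
    generalize jacobiDn (1 - m) z.im = d' at *
    clear * - r1 r2 r3 r4
    grind
  have key' : (snRe m z.re z.im : ℂ) ^ 2 + (snIm m z.re z.im : ℂ) ^ 2
      = snDen m z.re z.im * nsDen m z.re z.im := by exact_mod_cast key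
  rw [complexSn, complexNs, div_mul_div_comm, div_eq_one_iff_eq (mul_ne_zero hD' hz'), ← key']
  push_cast
  linear_combination (-(snIm m z.re z.im : ℂ) ^ 2) * I_sq

theorem analyticAt_of_ne_zero {f : ℂ → ℂ} {D : ℂ → ℝ} (hD : Continuous D)
    (hf : ∀ z, D z ≠ 0 → DifferentiableAt ℂ f z) {z : ℂ} (hz : D z ≠ 0) : AnalyticAt ℂ f z := by
  have ho : IsOpen {z | D z ≠ 0} := isOpen_ne_fun hD continuous_const
  exact DifferentiableOn.analyticAt (s := {z | D z ≠ 0})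
    (fun w hw => (hf w hw).differentiableWithinAt) (ho.mem_nhds hz)

/-- Where `snDen` vanishes, `nsDen` equals 1, so ns is analytic there and sn is its reciprocal
nearby. Elsewhere sn is itself analytic. -/
theorem complexSn_meromorphicAt (h0 : 0 < m) (h1 : m < 1) (z : ℂ) :
    MeromorphicAt (complexSn m) z := by
  obtain ⟨-, -, d3, d4⟩ := sn_parts_differentiable h0 h1
  by_cases hD : snDen m z.re z.im = 0
  · obtain ⟨e1, e2⟩ := snDen_eq_zero h0 hD
    have hE : nsDen m z.re z.im ≠ 0 := by
      have := jacobiSn_sq_add (1 - m) z.im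
      rw [e2] at this
      rw [nsDen, e1, e2]
      intro h
      linarith
    have hg : AnalyticAt ℂ (complexNs m) z := analyticAt_of_ne_zero
      (D := fun z => nsDen m z.re z.im) d4.continuous
      (fun w hw => complexNs_differentiableAt h0 h1 hw) hE
    refine hg.meromorphicAt.inv.congr ?_
    refine Filter.Eventually.filter_mono nhdsWithin_le_nhds ?_
    have ho : IsOpen {w : ℂ | nsDen m w.re w.im ≠ 0} :=
      isOpen_ne_fun d4.continuous continuous_const
    filter_upwards [ho.mem_nhds hE] with w hw
    exact (complexSn_eq_inv h0 h1 hw).symm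
  · exact (analyticAt_of_ne_zero (D := fun z => snDen m z.re z.im) d3.continuous
      (fun w hw => complexSn_differentiableAt h0 h1 hw) hD).meromorphicAt

theorem complexSn_ofReal (h0 : 0 < m) (u : ℝ) : complexSn m u = jacobiSn m u := by
  have h : 1 - m < 1 := by linarith
  simp [complexSn, snRe, snIm, snDen, jacobiSn_zero h, jacobiCn_zero h, jacobiDn_zero h]

theorem complexSn_add_real (h0 : 0 ≤ m) (h1 : m < 1) (z : ℂ) :
    complexSn m (z + jacobiHalfPeriod m) = -complexSn m z := by
  simp only [complexSn, snRe, snIm, snDen, add_re, add_im, ofReal_re, ofReal_im, add_zero,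
    jacobiSn_add h0 h1, jacobiCn_add h0 h1, jacobiDn_add h0 h1, neg_sq]
  push_cast
  ring

theorem complexSn_add_imag (h0 : 0 < m) (h1 : m ≤ 1) (z : ℂ) :
    complexSn m (z + jacobiHalfPeriod (1 - m) * I) = complexSn m z := by
  have h2 : 0 ≤ 1 - m := by linarith
  have h3 : 1 - m < 1 := by linarith
  simp [complexSn, snRe, snIm, snDen, jacobiSn_add h2 h3, jacobiCn_add h2 h3, jacobiDn_add h2 h3]

end Complex

/-! ### Newton equations with an elliptic solution -/

/-- Uniqueness for the Newton equation `ÿ = F(y)` on an interval. -/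
theorem newton_unique {F : ℝ → ℝ} (hF : ContDiff ℝ 1 F) {J : Set ℝ} (hJ : IsOpen J)
    (hJc : J.OrdConnected) {y v z w : ℝ → ℝ} (hy : ∀ t ∈ J, HasDerivAt y (v t) t)
    (hv : ∀ t ∈ J, HasDerivAt v (F (y t)) t) (hz : ∀ t ∈ J, HasDerivAt z (w t) t)
    (hw : ∀ t ∈ J, HasDerivAt w (F (z t)) t) {t₀ : ℝ} (ht₀ : t₀ ∈ J) (e0 : y t₀ = z t₀)
    (e1 : v t₀ = w t₀) {t : ℝ} (ht : t ∈ J) : y t = z t := by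
  -- Openness of J leaves room beyond both times, giving a compact interval in J with t₀ and t in
  -- its interior.
  obtain ⟨l, hl, hlJ⟩ := exists_Ioc_subset_of_mem_nhds (hJ.mem_nhds (min_rec' (· ∈ J) ht₀ ht))
    ⟨min t₀ t - 1, by linarith⟩
  obtain ⟨u, hu, huJ⟩ := exists_Ico_subset_of_mem_nhds (hJ.mem_nhds (max_rec' (· ∈ J) ht₀ ht))
    ⟨max t₀ t + 1, by linarith⟩
  set a := (l + min t₀ t) / 2
  set b := (u + max t₀ t) / 2
  have ha : a ∈ J := hlJ ⟨by simp only [a]; linarith, by simp only [a]; linarith⟩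
  have hb : b ∈ J := huJ ⟨by simp only [b]; linarith, by simp only [b]; linarith⟩
  have hab : Set.Icc a b ⊆ J := hJc.out ha hb
  have ha' : a < min t₀ t := by simp only [a]; linarith
  have hb' : max t₀ t < b := by simp only [b]; linarith
  have hY : ∀ τ ∈ J, HasDerivAt (fun τ => (y τ, v τ)) (v τ, F (y τ)) τ :=
    fun τ h => (hy τ h).prodMk (hv τ h)
  have hZ : ∀ τ ∈ J, HasDerivAt (fun τ => (z τ, w τ)) (w τ, F (z τ)) τ :=
    fun τ h => (hz τ h).prodMk (hw τ h)
  have bd : ∀ G : ℝ → ℝ × ℝ, (∀ τ ∈ J, ContinuousAt G τ) →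
      ∃ R : ℝ, ∀ τ ∈ Set.Icc a b, G τ ∈ Metric.closedBall 0 R := by
    intro G hG
    obtain ⟨R, hR⟩ := (isCompact_Icc (a := a) (b := b)).exists_bound_of_continuousOn
      (f := G) fun τ h => (hG τ (hab h)).continuousWithinAt
    exact ⟨R, fun τ h => by simpa using hR τ h⟩
  obtain ⟨R₁, hR₁⟩ := bd _ fun τ h => (hY τ h).continuousAt
  obtain ⟨R₂, hR₂⟩ := bd _ fun τ h => (hZ τ h).continuousAt
  -- F need not be globally Lipschitz; the first-order field is C¹, hence Lipschitz on a closed ball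
  -- containing both phase curves over [a, b].
  have hV : ContDiff ℝ 1 fun p : ℝ × ℝ => (p.2, F p.1) :=
    contDiff_snd.prodMk (hF.comp contDiff_fst)
  obtain ⟨K, hK⟩ := hV.contDiffOn.exists_lipschitzOnWith one_ne_zero
    (convex_closedBall (0 : ℝ × ℝ) (max R₁ R₂)) (isCompact_closedBall _ _)
  have := ODE_solution_unique_of_mem_Ioo (v := fun _ p => (p.2, F p.1)) (K := K)
    (s := fun _ => Metric.closedBall (0 : ℝ × ℝ) (max R₁ R₂)) (a := a) (b := b) (t₀ := t₀)
    (f := fun τ => (y τ, v τ)) (g := fun τ => (z τ, w τ)) (fun _ _ => hK)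
    ⟨ha'.trans_le (min_le_left _ _), (le_max_left _ _).trans_lt hb'⟩
    (fun τ h => ⟨hY τ (hab (Set.Ioo_subset_Icc_self h)), Metric.closedBall_subset_closedBall
      (le_max_left _ _) (hR₁ τ (Set.Ioo_subset_Icc_self h))⟩)
    (fun τ h => ⟨hZ τ (hab (Set.Ioo_subset_Icc_self h)), Metric.closedBall_subset_closedBall
      (le_max_right _ _) (hR₂ τ (Set.Ioo_subset_Icc_self h))⟩)
    (by rw [e0, e1])
    ⟨ha'.trans_le (min_le_right _ _), (le_max_right _ _).trans_lt hb'⟩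
  exact congrArg Prod.fst this

/-- The function `α + β sn² (ω z + c)`. -/
noncomputable def ellipticSolution (m α β ω c : ℝ) (z : ℂ) : ℂ :=
  α + β * complexSn m (ω * z + c) ^ 2

theorem isElliptic_ellipticSolution {m : ℝ} (h0 : 0 < m) (h1 : m < 1) (α β : ℝ) {ω : ℝ}
    (hω : ω ≠ 0) (c : ℝ) : IsElliptic (ellipticSolution m α β ω c) := by
  have hωc : (ω : ℂ) ≠ 0 := by exact_mod_cast hω
  refine ⟨fun z => ?_, ((jacobiHalfPeriod m / ω : ℝ) : ℂ),
    ((jacobiHalfPeriod (1 - m) / ω : ℝ) : ℂ) * I, ?_, fun z => ⟨?_, ?_⟩⟩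
  · have ha : AnalyticAt ℂ (fun z : ℂ => (ω : ℂ) * z + c) z := by fun_prop
    exact (MeromorphicAt.const (α : ℂ) z).add ((MeromorphicAt.const (β : ℂ) z).mul
      (((complexSn_meromorphicAt h0 h1 _).comp_analyticAt ha).pow 2))
  · have p1 := (jacobiHalfPeriod_pos h1).ne'
    have p2 := (jacobiHalfPeriod_pos (m := 1 - m) (by linarith)).ne'
    rw [LinearIndependent.pair_iff]
    intro x y h
    have hre := congrArg Complex.re h
    have him := congrArg Complex.im h
    simp only [add_re, add_im, Complex.real_smul, Complex.re_ofReal_mul, Complex.im_ofReal_mul,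
      ofReal_re, ofReal_im, I_re, I_im, mul_zero, mul_one, add_zero, zero_add, zero_re, zero_im]
      at hre him
    exact ⟨(mul_eq_zero.1 hre).resolve_right (div_ne_zero p1 hω),
      (mul_eq_zero.1 him).resolve_right (div_ne_zero p2 hω)⟩
  · have e : (ω : ℂ) * (z + ((jacobiHalfPeriod m / ω : ℝ) : ℂ)) + c
        = (ω * z + c) + jacobiHalfPeriod m := by
      push_cast; field_simp; ring
    rw [ellipticSolution, e, complexSn_add_real h0.le h1, neg_sq, ellipticSolution]
  · have e : (ω : ℂ) * (z + ((jacobiHalfPeriod (1 - m) / ω : ℝ) : ℂ) * I) + c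
        = (ω * z + c) + jacobiHalfPeriod (1 - m) * I := by
      push_cast; field_simp; ring
    rw [ellipticSolution, e, complexSn_add_imag h0 h1.le, ellipticSolution]

theorem ellipticSolution_ofReal {m : ℝ} (h0 : 0 < m) (α β ω c t : ℝ) :
    ellipticSolution m α β ω c t = ((α + β * jacobiSn m (ω * t + c) ^ 2 : ℝ) : ℂ) := by
  rw [ellipticSolution, ← ofReal_mul, ← ofReal_add, complexSn_ofReal h0]
  push_cast
  rfl

/-- The case of three real roots `α, β, γ`, with `β` between `α` and `γ`, and motion between
`α` and `β`. -/
theorem exists_isElliptic_of_roots {p : ℝ[X]} {L α β γ : ℝ}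
    (hp : p = C L * (X - C α) * (X - C β) * (X - C γ)) (hL : 0 < L * (γ - α))
    (hm0 : 0 < (β - α) / (γ - α)) (hm1 : (β - α) / (γ - α) < 1)
    {J : Set ℝ} (hJ : IsOpen J) (hJc : J.OrdConnected) {y v : ℝ → ℝ}
    (hy : ∀ t ∈ J, HasDerivAt y (v t) t)
    (hv : ∀ t ∈ J, HasDerivAt v (p.derivative.eval (y t) / 8) t)
    (he : ∀ t ∈ J, 4 * v t ^ 2 = p.eval (y t)) {t₀ : ℝ} (ht₀ : t₀ ∈ J)
    (hq0 : 0 < (y t₀ - α) / (β - α)) (hq1 : (y t₀ - α) / (β - α) < 1) :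
    ∃ f : ℂ → ℂ, IsElliptic f ∧ ∀ t ∈ J, f (t : ℂ) = (y t : ℂ) := by
  set m := (β - α) / (γ - α) with hm
  have hγ : γ - α ≠ 0 := by rintro h; rw [h] at hL; simp at hL
  have hβ : β - α ≠ 0 := by rintro h; rw [hm, h] at hm0; simp at hm0
  have hmβ : β - α = m * (γ - α) := by rw [hm]; field_simp
  -- Substituting y = α + (β - α) sn²(ωt + c) in 4 ẏ² = p(y) cancels all factors except 16 ω² = L(γ
  -- - α).
  set ω := Real.sqrt (L * (γ - α)) / 4 with hω
  have hωp : 0 < ω := by have := Real.sqrt_pos.2 hL; positivity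
  have hω2 : 16 * ω ^ 2 = L * (γ - α) := by
    rw [hω, div_pow, Real.sq_sqrt hL.le]; ring
  have hev : ∀ q, p.eval q = L * (q - α) * (q - β) * (q - γ) := by
    intro q; rw [hp]; simp
  have hdev : ∀ q, p.derivative.eval q
      = L * ((q - β) * (q - γ) + (q - α) * (q - γ) + (q - α) * (q - β)) := by
    intro q; rw [hp]; simp [derivative_mul]; ring
  set S := (y t₀ - α) / (β - α) with hS
  have hyS : y t₀ = α + (β - α) * S := by rw [hS]; field_simp; ring
  set θ := Real.arcsin (Real.sqrt S)
  have hθ : Real.sin θ = Real.sqrt S := Real.sin_arcsin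
    (by linarith [Real.sqrt_nonneg S]) (Real.sqrt_le_one.2 hq1.le)
  have sol : ∀ c t, HasDerivAt (fun t => α + (β - α) * jacobiSn m (ω * t + c) ^ 2)
      (2 * ω * (β - α) * (jacobiSn m (ω * t + c) * jacobiCn m (ω * t + c)
        * jacobiDn m (ω * t + c))) t ∧
      HasDerivAt (fun t => 2 * ω * (β - α) * (jacobiSn m (ω * t + c) * jacobiCn m (ω * t + c)
        * jacobiDn m (ω * t + c)))
        (p.derivative.eval (α + (β - α) * jacobiSn m (ω * t + c) ^ 2) / 8) t := by
    intro c t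
    have hlin : HasDerivAt (fun t => ω * t + c) ω t := by
      simpa using ((hasDerivAt_id t).const_mul ω).add_const c
    have hs : HasDerivAt (fun t => jacobiSn m (ω * t + c)) _ t :=
      HasDerivAt.comp (h₂ := jacobiSn m) t (hasDerivAt_jacobiSn hm0.le hm1 (ω * t + c)) hlin
    have hc : HasDerivAt (fun t => jacobiCn m (ω * t + c)) _ t :=
      HasDerivAt.comp (h₂ := jacobiCn m) t (hasDerivAt_jacobiCn hm0.le hm1 (ω * t + c)) hlin
    have hd : HasDerivAt (fun t => jacobiDn m (ω * t + c)) _ t :=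
      HasDerivAt.comp (h₂ := jacobiDn m) t (hasDerivAt_jacobiDn hm0.le hm1 (ω * t + c)) hlin
    have r1 := jacobiSn_sq_add m (ω * t + c)
    have r2 := jacobiDn_sq hm1 (ω * t + c)
    refine ⟨(((hs.pow 2).const_mul (β - α)).const_add α).congr_deriv (by push_cast; ring),
      (((hs.mul hc).mul hd).const_mul (2 * ω * (β - α))).congr_deriv ?_⟩
    rw [hdev]
    simp only [Pi.mul_apply]
    generalize jacobiSn m (ω * t + c) = s at *
    generalize jacobiCn m (ω * t + c) = k at *
    generalize jacobiDn m (ω * t + c) = n at *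
    have hk : k ^ 2 = 1 - s ^ 2 := by linarith
    have lhs : 2 * ω * (β - α) * ((k * n * ω * k + s * (-s * n * ω)) * n
        + s * k * (-m * s * k * ω))
        = 2 * ω ^ 2 * (β - α) * (k ^ 2 * n ^ 2 - s ^ 2 * n ^ 2 - m * s ^ 2 * k ^ 2) := by ring
    have hα : α + (β - α) * s ^ 2 - γ = (γ - α) * (m * s ^ 2 - 1) := by rw [hmβ]; ring
    have hω' : ω ^ 2 = L * (γ - α) / 16 := by linarith
    refine lhs.trans ?_
    rw [hα, hk, r2, hω', show α + (β - α) * s ^ 2 - β = (β - α) * (s ^ 2 - 1) by ring,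
      show α + (β - α) * s ^ 2 - α = (β - α) * s ^ 2 by ring]
    have : (β - α) * (β - α) = (β - α) * (m * (γ - α)) := by rw [← hmβ]
    linear_combination (- (L / 8) * s ^ 2 * (s ^ 2 - 1)) * this
  have hF : ContDiff ℝ 1 fun q => p.derivative.eval q / 8 := by
    simp only [hdev]
    fun_prop
  -- It remains to choose the phase c so that position and velocity agree at t₀; Newton uniqueness
  -- then gives equality on J.
  have fin : ∀ c, jacobiSn m (ω * t₀ + c) ^ 2 = S →
      v t₀ = 2 * ω * (β - α) * (jacobiSn m (ω * t₀ + c) * jacobiCn m (ω * t₀ + c)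
        * jacobiDn m (ω * t₀ + c)) →
      ∃ f : ℂ → ℂ, IsElliptic f ∧ ∀ t ∈ J, f (t : ℂ) = (y t : ℂ) := by
    intro c h1 h2
    refine ⟨_, isElliptic_ellipticSolution hm0 hm1 α (β - α) hωp.ne' c, fun t ht => ?_⟩
    rw [ellipticSolution_ofReal hm0]
    congr 1
    exact (newton_unique hF hJ hJc hy hv (fun τ _ => (sol c τ).1) (fun τ _ => (sol c τ).2) ht₀
      (by rw [h1, hyS]) h2 ht).symm
  set T := 2 * ω * (β - α) * (Real.sqrt S * Real.cos θ * Real.sqrt (1 - m * S)) with hT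
  have hT2 : v t₀ ^ 2 = T ^ 2 := by
    have h1 := he t₀ ht₀
    have h2 : Real.cos θ ^ 2 = 1 - S := by
      rw [Real.cos_sq', hθ, Real.sq_sqrt hq0.le]
    have h3 : Real.sqrt (1 - m * S) ^ 2 = 1 - m * S := Real.sq_sqrt (by nlinarith)
    have h4 : T ^ 2 = 4 * ω ^ 2 * (β - α) ^ 2 * (S * (1 - S) * (1 - m * S)) := by
      rw [hT]
      simp only [mul_pow, Real.sq_sqrt hq0.le, h2, h3]
      ring
    rw [hev, hyS, show α + (β - α) * S - γ = (γ - α) * (m * S - 1) by rw [hmβ]; ring] at h1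
    rw [h4]
    linear_combination 1 / 4 * h1 - 1 / 4 * (β - α) ^ 2 * (S * (1 - S) * (1 - m * S)) * hω2
  have hsn : ∀ φ, jacobiSn m (ω * t₀ + (ellipticF m φ - ω * t₀)) = Real.sin φ ∧
      jacobiCn m (ω * t₀ + (ellipticF m φ - ω * t₀)) = Real.cos φ ∧
      jacobiDn m (ω * t₀ + (ellipticF m φ - ω * t₀)) = Real.sqrt (1 - m * Real.sin φ ^ 2) := by
    intro φ
    rw [add_sub_cancel, jacobiDn, jacobiSn, jacobiCn, jacobiAm_ellipticF hm1]
    exact ⟨rfl, rfl, rfl⟩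
  -- The energy relation fixes the velocity up to sign. Amplitude θ or -θ at time t₀ gives the same
  -- sn² and opposite velocities.
  rcases sq_eq_sq_iff_eq_or_eq_neg.1 hT2 with h | h
  · refine fin (ellipticF m θ - ω * t₀) ?_ ?_
    · rw [(hsn θ).1, hθ, Real.sq_sqrt hq0.le]
    · rw [(hsn θ).1, (hsn θ).2.1, (hsn θ).2.2, hθ, Real.sq_sqrt hq0.le, h]
  · refine fin (ellipticF m (-θ) - ω * t₀) ?_ ?_
    · rw [(hsn (-θ)).1, Real.sin_neg, neg_sq, hθ, Real.sq_sqrt hq0.le]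
    · rw [(hsn (-θ)).1, (hsn (-θ)).2.1, (hsn (-θ)).2.2, Real.sin_neg, neg_sq, Real.cos_neg, hθ,
        Real.sq_sqrt hq0.le, h, hT]
      ring

/-- Removing two linear factors from a cubic leaves a real polynomial of degree one, whose root is
real. -/
theorem exists_third_root {p : ℝ[X]} (hdeg : p.natDegree = 3) {e₁ e₂ : ℝ} (h1 : p.eval e₁ = 0)
    (h2 : p.eval e₂ = 0) (hne : e₁ ≠ e₂) :
    ∃ L e₃ : ℝ, L ≠ 0 ∧ p = C L * (X - C e₁) * (X - C e₂) * (X - C e₃) := by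
  have hp0 : p ≠ 0 := by rintro rfl; simp at hdeg
  obtain ⟨p₁, rfl⟩ := dvd_iff_isRoot.2 h1
  have h2' : p₁.eval e₂ = 0 := by
    rw [eval_mul, eval_sub, eval_X, eval_C] at h2
    exact (mul_eq_zero.1 h2).resolve_left (sub_ne_zero.2 hne.symm)
  obtain ⟨p₂, rfl⟩ := dvd_iff_isRoot.2 h2'
  have n1 := left_ne_zero_of_mul hp0
  have n2 := left_ne_zero_of_mul (right_ne_zero_of_mul hp0)
  have n3 := right_ne_zero_of_mul (right_ne_zero_of_mul hp0)
  rw [natDegree_mul n1 (mul_ne_zero n2 n3), natDegree_mul n2 n3, natDegree_X_sub_C,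
    natDegree_X_sub_C] at hdeg
  have hd2 : p₂.natDegree = 1 := by omega
  have hL : p₂.coeff 1 ≠ 0 := by
    rw [← hd2, coeff_natDegree]; exact leadingCoeff_ne_zero.2 n3
  have he := eq_X_add_C_of_natDegree_le_one hd2.le
  refine ⟨p₂.coeff 1, -p₂.coeff 0 / p₂.coeff 1, hL, ?_⟩
  have : C (p₂.coeff 1) * C (-p₂.coeff 0 / p₂.coeff 1) = -C (p₂.coeff 0) := by
    rw [← C_mul, ← C_neg]; congr 1; field_simp
  conv_lhs => rw [he]
  linear_combination ((X - C e₁) * (X - C e₂)) * this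

/-- Bounded motions with `4 ẏ² = p(y)`, where `p` is a cubic polynomial without multiple roots,
are elliptic functions of time. -/
theorem exists_isElliptic_of_cubic {p : ℝ[X]} (hdeg : p.natDegree = 3) (hsep : p.Separable)
    {J : Set ℝ} (hJ : IsOpen J) (hJc : J.OrdConnected) (hne : J.Nonempty) {y v : ℝ → ℝ}
    (hy : ∀ t ∈ J, HasDerivAt y (v t) t)
    (hv : ∀ t ∈ J, HasDerivAt v (p.derivative.eval (y t) / 8) t)
    (he : ∀ t ∈ J, 4 * v t ^ 2 = p.eval (y t)) {B : ℝ} (hB : ∀ t ∈ J, |y t| ≤ B)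
    (hp1 : p.eval (-B) ≤ 0) (hp2 : p.eval B ≤ 0) :
    ∃ f : ℂ → ℂ, IsElliptic f ∧ ∀ t ∈ J, f (t : ℂ) = (y t : ℂ) := by
  -- Otherwise p(y) and v vanish throughout J; the acceleration then vanishes as well, so y is a
  -- common root of p and p', against separability.
  obtain ⟨t₀, ht₀, hpos⟩ : ∃ t₀ ∈ J, 0 < p.eval (y t₀) := by
    by_contra hcon
    push Not at hcon
    have hz : ∀ t ∈ J, p.eval (y t) = 0 := fun t ht =>
      le_antisymm (hcon t ht) (by rw [← he t ht]; positivity)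
    obtain ⟨t, ht⟩ := hne
    have hv0 : ∀ u ∈ J, v u = 0 := by
      intro u hu
      have := he u hu
      rw [hz u hu] at this
      simpa using this
    have hd : HasDerivAt v 0 t := (hasDerivAt_const t (0 : ℝ)).congr_of_eventuallyEq (by
      filter_upwards [hJ.mem_nhds ht] with u hu
      exact hv0 u hu)
    have h8 := (hv t ht).unique hd
    have hd0 : p.derivative.eval (y t) = 0 := by linarith
    exact hsep.aeval_derivative_ne_zero (x := y t) (by simpa using hz t ht) (by simpa using hd0)
  set Q := y t₀
  have hQ := abs_le.1 (hB t₀ ht₀)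
  have hQ1 : -B < Q := lt_of_le_of_ne hQ.1 (by rintro h; rw [h] at hp1; linarith)
  have hQ2 : Q < B := lt_of_le_of_ne hQ.2 (by rintro h; rw [← h] at hp2; linarith)
  -- These roots enclose Q but need not be adjacent: the third root may lie between them.
  obtain ⟨e₁, he₁, r₁⟩ := intermediate_value_Icc hQ1.le p.continuous.continuousOn ⟨hp1, hpos.le⟩
  obtain ⟨e₂, he₂, r₂⟩ := intermediate_value_Icc' hQ2.le p.continuous.continuousOn ⟨hp2, hpos.le⟩
  simp only at r₁ r₂
  have h1 : e₁ < Q := lt_of_le_of_ne he₁.2 (by rintro h; rw [h] at r₁; linarith)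
  have h2 : Q < e₂ := lt_of_le_of_ne he₂.1 (by rintro h; rw [← h] at r₂; linarith)
  obtain ⟨L, e₃, hL, hp⟩ := exists_third_root hdeg r₁ r₂ (h1.trans h2).ne
  have h31 : e₃ ≠ e₁ := by
    rintro rfl
    exact not_isUnit_X_sub_C e₃ (isUnit_of_self_mul_dvd_separable hsep
      ⟨C L * (X - C e₂), by rw [hp]; ring⟩)
  have h32 : e₃ ≠ e₂ := by
    rintro rfl
    exact not_isUnit_X_sub_C e₃ (isUnit_of_self_mul_dvd_separable hsep
      ⟨C L * (X - C e₁), by rw [hp]; ring⟩)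
  have hsgn : L * (Q - e₃) < 0 := by
    have h : 0 < L * (Q - e₁) * (Q - e₂) * (Q - e₃) := by
      rw [hp] at hpos; simpa using hpos
    have h' : 0 < (Q - e₁) * (e₂ - Q) := mul_pos (by linarith) (by linarith)
    by_contra hc
    push Not at hc
    nlinarith [mul_nonneg hc h'.le]
  have hp12 : p = C L * (X - C e₂) * (X - C e₁) * (X - C e₃) := by rw [hp]; ring
  have hp13 : p = C L * (X - C e₁) * (X - C e₃) * (X - C e₂) := by rw [hp]; ring
  have hp23 : p = C L * (X - C e₂) * (X - C e₃) * (X - C e₁) := by rw [hp]; ring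
  -- The sign of L decides on which side of Q the root e₃ lies. In every case α is the enclosing
  -- root on the opposite side, and β, γ are the other two in order of distance from Q.
  rcases lt_or_gt_of_ne hL with hneg | hLpos
  · have h3 : e₃ < Q := by nlinarith
    rcases lt_or_gt_of_ne h31 with h | h
    · exact exists_isElliptic_of_roots hp12 (mul_pos_of_neg_of_neg hneg (by linarith))
        (div_pos_of_neg_of_neg (by linarith) (by linarith))
        ((div_lt_one_of_neg (by linarith)).2 (by linarith)) hJ hJc hy hv he ht₀
        (div_pos_of_neg_of_neg (by linarith) (by linarith))
        ((div_lt_one_of_neg (by linarith)).2 (by linarith))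
    · exact exists_isElliptic_of_roots hp23 (mul_pos_of_neg_of_neg hneg (by linarith))
        (div_pos_of_neg_of_neg (by linarith) (by linarith))
        ((div_lt_one_of_neg (by linarith)).2 (by linarith)) hJ hJc hy hv he ht₀
        (div_pos_of_neg_of_neg (by linarith) (by linarith))
        ((div_lt_one_of_neg (by linarith)).2 (by linarith))
  · have h3 : Q < e₃ := by nlinarith
    rcases lt_or_gt_of_ne h32 with h | h
    · exact exists_isElliptic_of_roots hp13 (mul_pos hLpos (by linarith))
        (div_pos (by linarith) (by linarith)) ((div_lt_one (by linarith)).2 (by linarith))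
        hJ hJc hy hv he ht₀
        (div_pos (by linarith) (by linarith)) ((div_lt_one (by linarith)).2 (by linarith))
    · exact exists_isElliptic_of_roots hp (mul_pos hLpos (by linarith))
        (div_pos (by linarith) (by linarith)) ((div_lt_one (by linarith)).2 (by linarith))
        hJ hJc hy hv he ht₀
        (div_pos (by linarith) (by linarith)) ((div_lt_one (by linarith)).2 (by linarith))

end NWave

/-! ### The main theorem -/

theorem mainTheorem3 (a : Fin 2 → ℝ) (d : Fin 3 → ℝ) (s : Fin 2 → ℝ)
    (ha : a 0 ≠ a 1) (hd : d 0 ≠ d 1) (hs : ∀ k, 0 < s k) :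
    -- the case `s_3 = 0` of the matrix system
    (∀ Z : ℝ → Matrix (Fin 2) (Fin 3) ℂ, IsMatTrajectory (matH a d) Z →
      (∀ t k, sOf (Z t) k = sOf (Z 0) k) ∧
      (sOf (Z 0) 0 = s 0 → sOf (Z 0) 1 = s 1 → sOf (Z 0) 2 = 0 →
        (∀ t, rEta (Z t) 2 = 0 ∧
          matH a d (Z t) = leafH a d s (fun k => rEta (Z t) k.castSucc)) ∧
        IsLeafTrajectory s (leafH a d s) Set.univ
          (fun t k => rEta (Z (-t / 2)) k.castSucc))) ∧
    -- `(r_k, φ_k)` are canonical coordinates on the leaf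
    (∀ f g : Space → ℝ, ContDiff ℝ 1 f → ContDiff ℝ 1 g →
      ∀ q φ : Fin 2 → ℝ, (∀ k, |q k| < s k) →
        bracket (fun y => (f y : ℂ)) (fun y => (g y : ℂ)) (polar s q φ) =
          ((∑ k, (deriv (fun u => f (polar s (Function.update q k u) φ)) (q k)
                * deriv (fun u => g (polar s q (Function.update φ k u))) (φ k)
              - deriv (fun u => f (polar s q (Function.update φ k u))) (φ k)
                * deriv (fun u => g (polar s (Function.update q k u) φ)) (q k)) : ℝ) : ℂ)) ∧
    -- the flow of `R`
    (∀ x : ℝ → Space, IsLeafTrajectory s leafR Set.univ x ↔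
      x 0 ∈ leaf s ∧ ∀ t, x t = rFlow (-t) (x 0)) ∧
    -- the reduced system for each level `R = r`
    (∀ r : ℝ,
      -- coordinates on the reduced phase space
      Set.BijOn (fun p : ℝ × ℝ => reducedChart s r p.1 p.2)
        (reducedRange s r ×ˢ Set.Ioc (-Real.pi) Real.pi) (reducedRegular s r) ∧
      (∀ q φ : Fin 2 → ℝ, q 0 + q 1 = r →
        orbit (polar s q φ) = reducedChart s r (q 0) (φ 0 - φ 1)) ∧
      -- the reduced Hamiltonian and the reduced symplectic form `dr_1 ∧ dψ_1`
      (∀ q ∈ reducedRange s r, ∀ ψ : ℝ,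
        orbitH a d s (reducedChart s r q ψ) = reducedH a d s r q ψ) ∧
      (∀ f g : Space → ℝ, ContDiff ℝ 1 f → ContDiff ℝ 1 g →
        (∀ φ x, f (rFlow φ x) = f x) → (∀ φ x, g (rFlow φ x) = g x) →
        ∀ q ∈ reducedRange s r, ∀ ψ : ℝ,
          bracket (fun y => (f y : ℂ)) (fun y => (g y : ℂ)) (slice s r q ψ) =
            ((deriv (fun u => f (slice s r u ψ)) q * deriv (fun u => g (slice s r q u)) ψ
              - deriv (fun u => f (slice s r q u)) ψ
                * deriv (fun u => g (slice s r u ψ)) q : ℝ) : ℂ)) ∧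
      -- solutions of the reduced system are solutions on the leaf modulo the flow of `R`
      (∀ (J : Set ℝ) (q ψ : ℝ → ℝ), IsOpen J → J.OrdConnected →
        (∀ t ∈ J, q t ∈ reducedRange s r) →
        (∀ x : ℝ → Space, IsLeafTrajectory s (leafH a d s) J x → ContinuousOn ψ J →
          (∀ t ∈ J, orbit (x t) = reducedChart s r (q t) (ψ t)) →
          IsCanonicalSolution (reducedH a d s r) J q ψ) ∧
        (IsCanonicalSolution (reducedH a d s r) J q ψ →
          ∃ x : ℝ → Space, IsLeafTrajectory s (leafH a d s) J x ∧
            ∀ t ∈ J, orbit (x t) = reducedChart s r (q t) (ψ t))) ∧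
      -- the solution
      (∀ h : ℝ,
        (w4 a d s r h).natDegree = 3 ∧
        (w4 a d s r h).leadingCoeff = 2 * (a 0 - a 1) * (d 0 - d 1) ∧
        ∀ (J : Set ℝ) (x : ℝ → Space), IsOpen J → J.OrdConnected →
          IsLeafTrajectory s (leafH a d s) J x →
          (∃ t₀ ∈ J, leafR (x t₀) = r ∧ leafH a d s (x t₀) = h) →
          -- the integrals of motion
          (∀ t ∈ J, leafR (x t) = r ∧ leafH a d s (x t) = h) ∧
          -- the equation for `r_1`
          (∀ t ∈ J, DifferentiableAt ℝ (fun u => (x u 0).1) t ∧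
            4 * (deriv (fun u => (x u 0).1) t) ^ 2 = (w4 a d s r h).eval (x t 0).1) ∧
          -- the elliptic integral
          (∀ t₀ t₁ : ℝ, t₀ < t₁ → Set.Icc t₀ t₁ ⊆ J →
            (∀ t ∈ Set.Ioo t₀ t₁, 0 < (w4 a d s r h).eval (x t 0).1) →
            ∃ ε : ℝ, (ε = 1 ∨ ε = -1) ∧
              (∀ t ∈ Set.Ioo t₀ t₁, 0 < ε * deriv (fun u => (x u 0).1) t) ∧
              IntervalIntegrable (fun q => 1 / Real.sqrt ((w4 a d s r h).eval q))
                MeasureTheory.volume (x t₀ 0).1 (x t₁ 0).1 ∧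
              t₁ - t₀ = ε * (2 * ∫ q in (x t₀ 0).1..(x t₁ 0).1,
                1 / Real.sqrt ((w4 a d s r h).eval q))) ∧
          -- `r_1` is an elliptic function of time
          ((w4 a d s r h).Separable →
            ∃ f : ℂ → ℂ, IsElliptic f ∧ ∀ t ∈ J, f (t : ℂ) = ((x t 0).1 : ℂ)) ∧
          -- `ψ_1` in terms of `r_1`
          (∀ t ∈ J, (x t 0).1 ∈ reducedRange s r →
            ∀ ψ : ℝ, orbit (x t) = reducedChart s r (x t 0).1 ψ →
              ∀ c : ℝ, c = Real.arccos (2 * (h - (w2 a d s r).eval (x t 0).1)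
                  / Real.sqrt ((radicand s r).eval (x t 0).1)) →
                (0 ≤ ψ → ψ ≤ Real.pi → ψ = c) ∧
                (deriv (fun u => (x u 0).1) t ≤ 0 → ∃ n : ℤ, ψ = c + 2 * Real.pi * n) ∧
                (0 ≤ deriv (fun u => (x u 0).1) t → ∃ n : ℤ, ψ = -c + 2 * Real.pi * n)))) := by
  refine ⟨fun Z hZ => matrix_system a d s Z hZ,
    fun f g hf hg q φ hq => bracket_polar (hf.differentiable one_ne_zero _)
      (hg.differentiable one_ne_zero _) hq,
    fun x => isLeafTrajectory_leafR_iff s x, fun r => ⟨bijOn_reducedChart hs r,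
      fun q φ h => orbit_polar s q φ h, fun q hq ψ => orbitH_reducedChart a d hq ψ,
      fun f g hf hg hfi hgi q hq ψ => bracket_slice (hf.differentiable one_ne_zero)
        (hg.differentiable one_ne_zero) hfi hgi hq,
      fun J q ψ hJ hJc hq => ⟨fun x hx hψ h => hx.isCanonicalSolution hJ hq hψ h,
        fun h => h.exists_isLeafTrajectory hJ hJc hq⟩, fun h => ⟨w4_natDegree s r h ha hd,
          w4_leadingCoeff s r h ha hd, ?_⟩⟩⟩
  rintro J x hJ hJc hx ⟨u, hu, hur, huh⟩
  have hint : ∀ t ∈ J, leafR (x t) = r ∧ leafH a d s (x t) = h := fun t ht =>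
    ⟨(hx.leafR_eq hJ hJc ht hu).trans hur, (hx.leafH_eq hJ hJc ht hu).trans huh⟩
  have hsq : ∀ t ∈ J, 4 * (-2 * ((x t 0).2 * (starRingEnd ℂ) (x t 1).2).im) ^ 2
      = (w4 a d s r h).eval (x t 0).1 := fun t ht =>
    hx.four_mul_sq ht (hint t ht).1 (hint t ht).2
  have hvel := fun t ht => hx.hasDerivAt_velocity (t := t) ht (hint t ht).1 (hint t ht).2
  refine ⟨hint, fun t ht => ⟨(hx.hasDerivAt_fst_zero ht).differentiableAt, ?_⟩,
    fun t₀ t₁ hlt hsub hpos => ?_, fun hsep => ?_,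
    fun t ht hq ψ hψ c hc => hx.angle_eq ht (hint t ht).1 (hint t ht).2 hq hψ hc⟩
  · rw [(hx.hasDerivAt_fst_zero ht).deriv]
    exact hsq t ht
  · obtain ⟨ε, h1, h2, h3, h4⟩ := elliptic_integral_of_deriv (f := fun t => (x t 0).1)
      (p := fun q => (w4 a d s r h).eval q) hlt (fun t ht => hx.hasDerivAt_fst_zero (hsub ht))
      (fun t ht => (hvel t (hsub ht)).continuousAt.continuousWithinAt) hpos
      (fun t ht => hsq t (hsub (Set.Ioo_subset_Icc_self ht)))
    refine ⟨ε, h1, fun t ht => ?_, h3, h4⟩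
    rw [(hx.hasDerivAt_fst_zero (hsub (Set.Ioo_subset_Icc_self ht))).deriv]
    exact h2 t ht
  -- At r₁ = ±s₁ the product of sphere factors vanishes and w₄ is minus a square, so B = s₁ supplies
  -- the confining bounds.
  · have hend : ∀ q, q ^ 2 = s 0 ^ 2 → (w4 a d s r h).eval q ≤ 0 := by
      intro q hq
      rw [w4_eval, radicand_eval, hq, sub_self, zero_mul, zero_sub, neg_nonpos]
      positivity
    exact exists_isElliptic_of_cubic (w4_natDegree s r h ha hd) hsep hJ hJc ⟨u, hu⟩
      (fun t ht => hx.hasDerivAt_fst_zero ht) hvel hsq (B := s 0)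
      (fun t ht => abs_fst_le_of_mem_leaf hs (hx t ht).1 0) (hend _ (neg_sq _)) (hend _ rfl)
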